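/- **Definitions.** A *hypergraph category* is a symmetric monoidal category with a chosen special commutative Frobenius structure $(\mu_X,\eta_X,\delta_X,\epsilon_X)$ on every object $X$, such that the structure on $X\otimes Y$ is the one built from those on $X$ and on $Y$, and $\eta_I=\mathrm{id}_I=\epsilon_I$. A *hypergraph functor* is a strong symmetric monoidal functor that preserves the chosen Frobenius structures; it is *strict* if its coherence maps are identities. An *objectwise-free (OF) hypergraph category* is a triple $(\Lambda,\mathcal H,i)$ of a set $\Lambda$ (of *generators*), a strict hypergraph category $\mathcal H$ and an isomorphism of monoids $i\colon \mathrm{List}(\Lambda)\cong\mathrm{ob}\,\mathcal H$. Let $\mathbf{Hyp}_{OF}$ be the category of OF-hypergraph categories and strict hypergraph functors, and let $\mathbf{Set}_{\mathrm{List}}$ be the Kleisli category of the list monad on sets: a morphism $\Lambda\to\Lambda'$ is a function $\Lambda\to\mathrm{List}(\Lambda')$. The functor $\mathrm{Gens}\colon\mathbf{Hyp}_{OF}\to\mathbf{Set}_{\mathrm{List}}$ sends $(\Lambda,\mathcal H,i)$ to $\Lambda$, and $F\colon(\Lambda,\mathcal H,i)\to(\Lambda',\mathcal H',i')$ to $a\mapsto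 i'^{-1}(F(i[a]))$. For a set $\Lambda$, let $\mathbf{Hyp}_{OF(\Lambda)}$ be the category of strict hypergraph categories whose monoid of objects is $\mathrm{List}(\Lambda)$ (so that $i=\mathrm{id}$), with the identity-on-objects strict hypergraph functors. Write $\mathbf{Hyp}_{OF}'\subseteq\mathbf{Hyp}_{OF}$ for the full subcategory of the OF-hypergraph categories that belong to some $\mathbf{Hyp}_{OF(\Lambda)}$. For a hypergraph functor $F\colon\mathcal H_1\to\mathcal H_2$ let $\mathcal H_F$ be the hypergraph category whose objects, and whose unit and product on objects, are those of $\mathcal H_1$, with $\mathcal H_F(x,y)=\mathcal H_2(Fx,Fy)$ and with the product of morphisms, the symmetries and the Frobenius structures taken from $\mathcal H_2$ (through the coherence maps of $F$). For $(\Lambda_2,\mathcal H,i)$ in $\mathbf{Hyp}_{OF}$ and $g\colon\Lambda_1\to\Lambda_2$ in $\mathbf{Set}_{\mathrm{List}}$, let $g^*\mathcal H\in\mathbf{Hyp}_{OF(\Lambda_1)}$ be the hypergraph category with object monoid $\mathrm{List}(\Lambda_1)$ and $g^*\mathcal H(x,y)=\mathcal H(i(\bar g x),i(\bar g y))$, where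 $\bar g\colon\mathrm{List}(\Lambda_1)\to\mathrm{List}(\Lambda_2)$ is the monoid homomorphism extending $g$, and with all structure on morphisms taken from $\mathcal H$; let $\ell_g\colon g^*\mathcal H\to\mathcal H$ be the evident fully faithful strict hypergraph functor, equal to $x\mapsto i(\bar g x)$ on objects. **Proposition.** 1. Every hypergraph functor $F\colon\mathcal H_1\to\mathcal H_2$ is equal, as a hypergraph functor, to the composite of an identity-on-objects hypergraph functor $\mathcal H_1\to\mathcal H_F$ and a fully faithful one $\mathcal H_F\to\mathcal H_2$. 2. $\mathrm{Gens}\colon\mathbf{Hyp}_{OF}\to\mathbf{Set}_{\mathrm{List}}$ is a Grothendieck fibration. The morphisms $\ell_g$ are cartesian over $g$, and they are closed under composition on the nose: $(f\mathbin;g)^*\mathcal H=f^*g^*\mathcal H$ and $\ell_{f\mathbin;g}=\ell_f\mathbin;\ell_g$. 3. For every morphism $F\colon\mathcal H_1\to\mathcal H_2$ of $\mathbf{Hyp}_{OF}$, the factorization in (1) is one in $\mathbf{Hyp}_{OF}$ (with the generators of $\mathcal H_1$ as generators of $\mathcal H_F$), $\mathrm{Gens}$ sends $\mathcal H_1\to\mathcal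 H_F$ to an identity, and $\mathcal H_F\to\mathcal H_2$ is cartesian over $\mathrm{Gens}(F)$. If $\mathcal H_1\in\mathbf{Hyp}_{OF(\Lambda)}$ for some $\Lambda$, then $\mathcal H_F=\mathrm{Gens}(F)^*\mathcal H_2$, and $\mathcal H_F\to\mathcal H_2$ is the chosen lift $\ell_{\mathrm{Gens}(F)}$. 4. The inclusion $\mathbf{Hyp}_{OF}'\subseteq\mathbf{Hyp}_{OF}$ is an equivalence of categories. The restriction of $\mathrm{Gens}$ to $\mathbf{Hyp}_{OF}'$ is a split Grothendieck fibration: the same $\ell_g$ form a cleavage that is closed under composition and under identities on the nose. 5. $\Lambda\mapsto\mathbf{Hyp}_{OF(\Lambda)}$, $g\mapsto g^*$ is a (strict) functor $\mathbf{Set}_{\mathrm{List}}^{op}\to\mathbf{Cat}$, where $g^*$ sends $F\colon\mathcal H\to\mathcal K$ to the unique identity-on-objects strict hypergraph functor $g^*F$ with $g^*F\mathbin;\ell_g=\ell_g\mathbin;F$. Let $\int\mathbf{Hyp}_{OF(-)}$ be its Grothendieck construction: objects are the pairs of a set $\Lambda$ and an $\mathcal A\in\mathbf{Hyp}_{OF(\Lambda)}$,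 and morphisms $(\Lambda,\mathcal A)\to(\Lambda',\mathcal A')$ are the pairs of an $f\colon\Lambda\to\Lambda'$ in $\mathbf{Set}_{\mathrm{List}}$ and a $k\colon\mathcal A\to f^*\mathcal A'$ in $\mathbf{Hyp}_{OF(\Lambda)}$. Then $(\Lambda,\mathcal A)\mapsto\mathcal A$, $(f,k)\mapsto k\mathbin;\ell_f$ is an equivalence of categories $\int\mathbf{Hyp}_{OF(-)}\simeq\mathbf{Hyp}_{OF}$, and its composite with $\mathrm{Gens}$ is the projection to $\mathbf{Set}_{\mathrm{List}}$. -/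

import Mathlib

open CategoryTheory MonoidalCategory
universe v v₁ v₂ v₃ u u₁ u₂ u₃

namespace Hypergraph

section Basic

/-- A special commutative Frobenius structure `(μ, η, δ, ε)` on an object `X` of a braided (in
practice symmetric) monoidal category. -/
structure FrobeniusStructure {C : Type u} [Category.{v} C] [MonoidalCategory C]
    [BraidedCategory C] (X : C) where
  mul : X ⊗ X ⟶ X
  unit : 𝟙_ C ⟶ X
  comul : X ⟶ X ⊗ X
  counit : X ⟶ 𝟙_ C
  mul_assoc : mul ▷ X ≫ mul = (α_ X X X).hom ≫ X ◁ mul ≫ mul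
  unit_mul : unit ▷ X ≫ mul = (λ_ X).hom
  mul_comm : (β_ X X).hom ≫ mul = mul
  comul_assoc : comul ≫ comul ▷ X ≫ (α_ X X X).hom = comul ≫ X ◁ comul
  counit_comul : comul ≫ counit ▷ X = (λ_ X).inv
  comul_comm : comul ≫ (β_ X X).hom = comul
  frobenius_left : comul ▷ X ≫ (α_ X X X).hom ≫ X ◁ mul = mul ≫ comul
  frobenius_right : X ◁ comul ≫ (α_ X X X).inv ≫ mul ▷ X = mul ≫ comul
  special : comul ≫ mul = 𝟙 X

/-- A hypergraph category: a symmetric monoidal category with a chosen Frobenius structure on each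
object, compatible with the monoidal product and the monoidal unit. -/
class HypergraphCategory (C : Type u) [Category.{v} C] [MonoidalCategory C]
    [SymmetricCategory C] where
  frob : ∀ X : C, FrobeniusStructure X
  mul_tensor : ∀ X Y : C, (frob (X ⊗ Y)).mul =
    tensorμ X Y X Y ≫ ((frob X).mul ⊗ₘ (frob Y).mul)
  unit_tensor : ∀ X Y : C, (frob (X ⊗ Y)).unit =
    (λ_ (𝟙_ C)).inv ≫ ((frob X).unit ⊗ₘ (frob Y).unit)
  comul_tensor : ∀ X Y : C, (frob (X ⊗ Y)).comul =
    ((frob X).comul ⊗ₘ (frob Y).comul) ≫ tensorμ X X Y Y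
  counit_tensor : ∀ X Y : C, (frob (X ⊗ Y)).counit =
    ((frob X).counit ⊗ₘ (frob Y).counit) ≫ (λ_ (𝟙_ C)).hom
  unit_one : (frob (𝟙_ C)).unit = 𝟙 (𝟙_ C)
  counit_one : (frob (𝟙_ C)).counit = 𝟙 (𝟙_ C)

/-- The chosen Frobenius structure on `X`. -/
abbrev frob {C : Type u} [Category.{v} C] [MonoidalCategory C] [SymmetricCategory C]
    [HypergraphCategory C] (X : C) : FrobeniusStructure X := HypergraphCategory.frob X

open Functor.LaxMonoidal Functor.OplaxMonoidal

/-- A hypergraph functor: a strong symmetric monoidal functor that preserves the chosen Frobenius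
structures.  (`μ`, `ε` are the coherence maps of the functor and `δ`, `η` their inverses.) -/
structure HypergraphFunctor (C : Type u₁) [Category.{v₁} C] [MonoidalCategory C]
    [SymmetricCategory C] [HypergraphCategory C] (D : Type u₂) [Category.{v₂} D]
    [MonoidalCategory D] [SymmetricCategory D] [HypergraphCategory D] extends C ⥤ D where
  braided : toFunctor.Braided
  frob_mul : ∀ X : C, (frob (obj X)).mul = μ toFunctor X X ≫ map (frob X).mul
  frob_unit : ∀ X : C, (frob (obj X)).unit = ε toFunctor ≫ map (frob X).unit
  frob_comul : ∀ X : C, (frob (obj X)).comul = map (frob X).comul ≫ δ toFunctor X X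
  frob_counit : ∀ X : C, (frob (obj X)).counit = map (frob X).counit ≫ η toFunctor

attribute [instance] HypergraphFunctor.braided

/-- A strict monoidal category: the monoidal product is associative and unital on the nose and the
associators and unitors are identities. -/
class IsStrictMonoidal (C : Type u) [Category.{v} C] [MonoidalCategory C] : Prop where
  tensor_assoc : ∀ X Y Z : C, (X ⊗ Y) ⊗ Z = X ⊗ (Y ⊗ Z)
  unit_tensor : ∀ X : C, 𝟙_ C ⊗ X = X
  tensor_unit : ∀ X : C, X ⊗ 𝟙_ C = X
  associator_hom : ∀ X Y Z : C, (α_ X Y Z).hom = eqToHom (tensor_assoc X Y Z)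
  leftUnitor_hom : ∀ X : C, (λ_ X).hom = eqToHom (unit_tensor X)
  rightUnitor_hom : ∀ X : C, (ρ_ X).hom = eqToHom (tensor_unit X)

variable {C : Type u₁} [Category.{v₁} C] [MonoidalCategory C] [SymmetricCategory C]
  [HypergraphCategory C]
  {D : Type u₂} [Category.{v₂} D] [MonoidalCategory D] [SymmetricCategory D]
  [HypergraphCategory D]
  {E : Type u₃} [Category.{v₃} E] [MonoidalCategory E] [SymmetricCategory E]
  [HypergraphCategory E]

namespace HypergraphFunctor

/-- Strictness of a hypergraph functor: its coherence maps are identities. -/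
structure IsStrict (F : HypergraphFunctor C D) : Prop where
  obj_unit : 𝟙_ D = F.obj (𝟙_ C)
  obj_tensor : ∀ X Y : C, F.obj X ⊗ F.obj Y = F.obj (X ⊗ Y)
  ε_eq : ε F.toFunctor = eqToHom obj_unit
  μ_eq : ∀ X Y : C, μ F.toFunctor X Y = eqToHom (obj_tensor X Y)

/-- The identity hypergraph functor. -/
def id (C : Type u₁) [Category.{v₁} C] [MonoidalCategory C] [SymmetricCategory C]
    [HypergraphCategory C] : HypergraphFunctor C C where
  toFunctor := 𝟭 C
  braided := inferInstance
  frob_mul _ := by simp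
  frob_unit _ := by simp
  frob_comul _ := by simp
  frob_counit _ := by simp

/-- The composite of two hypergraph functors. -/
def comp (F : HypergraphFunctor C D) (G : HypergraphFunctor D E) : HypergraphFunctor C E where
  toFunctor := F.toFunctor ⋙ G.toFunctor
  braided := inferInstance
  frob_mul X := by simp [G.frob_mul, F.frob_mul]
  frob_unit X := by simp [G.frob_unit, F.frob_unit]
  frob_comul X := by simp [G.frob_comul, F.frob_comul]
  frob_counit X := by simp [G.frob_counit, F.frob_counit]

theorem ext_of_strict {F G : HypergraphFunctor C D} (hF : F.IsStrict) (hG : G.IsStrict)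
    (h : F.toFunctor = G.toFunctor) : F = G := by
  obtain ⟨F, bF, _, _, _, _⟩ := F
  obtain ⟨G, bG, _, _, _, _⟩ := G
  obtain rfl : F = G := h
  obtain rfl : bF = bG := by
    apply Functor.Braided.toMonoidal_injective
    apply Functor.Monoidal.toLaxMonoidal_injective
    apply Functor.LaxMonoidal.ext
    · exact hF.ε_eq.trans hG.ε_eq.symm
    · funext X Y
      exact (hF.μ_eq X Y).trans (hG.μ_eq X Y).symm
  rfl

theorem isStrict_id : (HypergraphFunctor.id C).IsStrict where
  obj_unit := rfl
  obj_tensor _ _ := rfl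
  ε_eq := rfl
  μ_eq _ _ := rfl

theorem IsStrict.comp {F : HypergraphFunctor C D} {G : HypergraphFunctor D E} (hF : F.IsStrict)
    (hG : G.IsStrict) : (F.comp G).IsStrict where
  obj_unit := hG.obj_unit.trans (congrArg G.obj hF.obj_unit)
  obj_tensor X Y := (hG.obj_tensor _ _).trans (congrArg G.obj (hF.obj_tensor X Y))
  ε_eq := by
    change ε (F.toFunctor ⋙ G.toFunctor) = _
    rw [Functor.LaxMonoidal.comp_ε, hG.ε_eq, hF.ε_eq, eqToHom_map]
    exact eqToHom_trans _ _
  μ_eq X Y := by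
    change μ (F.toFunctor ⋙ G.toFunctor) X Y = _
    rw [Functor.LaxMonoidal.comp_μ, hG.μ_eq, hF.μ_eq, eqToHom_map]
    exact eqToHom_trans _ _

end HypergraphFunctor


end Basic

section Induced

/-- Data on a type `X` of objects over a monoidal category `D`: a map on objects, a product and a
unit that this map preserves up to specified isomorphisms. -/
structure InducingData (X : Type u₁) (D : Type u₂) [Category.{v₂} D] [MonoidalCategory D] where
  obj : X → D
  tensor : X → X → X
  one : X
  μIso : ∀ x y : X, obj x ⊗ obj y ≅ obj (tensor x y)
  εIso : 𝟙_ D ≅ obj one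

variable {X : Type u₁} {D : Type u₂} [Category.{v₂} D] [MonoidalCategory D]

/-- The category with the given objects and with the hom-sets `D (obj x) (obj y)`. -/
def Induced (_ : InducingData X D) : Type u₁ := X

namespace Induced

variable (I : InducingData X D)

instance : Category.{v₂} (Induced I) where
  Hom x y := I.obj x ⟶ I.obj y
  id x := 𝟙 (I.obj x)
  comp f g := CategoryStruct.comp (obj := D) f g
  id_comp f := Category.id_comp (obj := D) f
  comp_id f := Category.comp_id (obj := D) f
  assoc f g h := Category.assoc (obj := D) f g h

/-- A morphism, regarded as a morphism of `D`. -/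
def hom {x y : Induced I} (f : x ⟶ y) : I.obj x ⟶ I.obj y := f

/-- A morphism of `D` between images, regarded as a morphism. -/
def ofHom {x y : Induced I} (f : I.obj x ⟶ I.obj y) : x ⟶ y := f

/-- The fully faithful functor to `D`. -/
def toBase : Induced I ⥤ D where
  obj := I.obj
  map f := f

instance : (toBase I).Faithful where
  map_injective h := h

instance : (toBase I).Full where
  map_surjective f := ⟨f, rfl⟩

/-- An isomorphism between images is an isomorphism. -/
def isoMk {x y : Induced I} (e : I.obj x ≅ I.obj y) : x ≅ y where
  hom := e.hom
  inv := e.inv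
  hom_inv_id := e.hom_inv_id
  inv_hom_id := e.inv_hom_id

/-- The monoidal operations: on objects the given ones, on morphisms those of `D`. -/
instance : MonoidalCategoryStruct (Induced I) where
  tensorObj x y := I.tensor x y
  whiskerLeft x y y' f := ofHom I (x := I.tensor x y) (y := I.tensor x y')
    ((I.μIso _ _).inv ≫ I.obj x ◁ hom I f ≫ (I.μIso _ _).hom)
  whiskerRight {x x'} f y := ofHom I (x := I.tensor x y) (y := I.tensor x' y)
    ((I.μIso _ _).inv ≫ hom I f ▷ I.obj y ≫ (I.μIso _ _).hom)
  tensorHom {x x' y y'} f g := ofHom I (x := I.tensor x y) (y := I.tensor x' y')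
    ((I.μIso _ _).inv ≫ (hom I f ⊗ₘ hom I g) ≫ (I.μIso _ _).hom)
  tensorUnit := I.one
  associator x y z := isoMk I (((I.μIso _ _).symm ≪≫ ((I.μIso x y).symm ⊗ᵢ Iso.refl (I.obj z))) ≪≫
    α_ (I.obj x) (I.obj y) (I.obj z) ≪≫ ((Iso.refl (I.obj x) ⊗ᵢ I.μIso y z) ≪≫ I.μIso _ _))
  leftUnitor x := isoMk I (((I.μIso _ _).symm ≪≫ (I.εIso.symm ⊗ᵢ Iso.refl (I.obj x))) ≪≫
    λ_ (I.obj x))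
  rightUnitor x := isoMk I (((I.μIso _ _).symm ≪≫ (Iso.refl (I.obj x) ⊗ᵢ I.εIso.symm)) ≪≫
    ρ_ (I.obj x))

/-- `toBase` preserves the monoidal operations. -/
def inducingFunctorData : Monoidal.InducingFunctorData (toBase I) where
  μIso := I.μIso
  εIso := I.εIso
  whiskerLeft_eq _ _ _ _ := rfl
  whiskerRight_eq _ _ := rfl
  tensorHom_eq _ _ := rfl
  associator_eq _ _ _ := rfl
  leftUnitor_eq _ := rfl
  rightUnitor_eq _ := rfl

instance : MonoidalCategory (Induced I) :=
  Monoidal.induced (toBase I) (inducingFunctorData I)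

instance : (toBase I).Monoidal :=
  Monoidal.fromInducedMonoidal (toBase I) (inducingFunctorData I)

theorem toBase_μ (x y : Induced I) :
    Functor.LaxMonoidal.μ (toBase I) x y = (I.μIso x y).hom := rfl

theorem toBase_δ (x y : Induced I) :
    Functor.OplaxMonoidal.δ (toBase I) x y = (I.μIso x y).inv := rfl

theorem toBase_ε : Functor.LaxMonoidal.ε (toBase I) = I.εIso.hom := rfl

theorem toBase_η : Functor.OplaxMonoidal.η (toBase I) = I.εIso.inv := rfl

instance [SymmetricCategory D] : BraidedCategory (Induced I) :=
  BraidedCategory.ofFaithful (toBase I)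
    (fun x y => isoMk I ((I.μIso _ _).symm ≪≫ β_ (I.obj x) (I.obj y) ≪≫ I.μIso _ _))
    (fun x y => by
      change (I.μIso x y).hom ≫ (I.μIso _ _).inv ≫ (β_ (I.obj x) (I.obj y)).hom ≫
        (I.μIso _ _).hom = _
      rw [Iso.hom_inv_id_assoc]
      rfl)

instance [SymmetricCategory D] : (toBase I).Braided where
  braided x y := by
    change (I.μIso x y).hom ≫ (I.μIso _ _).inv ≫ (β_ (I.obj x) (I.obj y)).hom ≫
      (I.μIso _ _).hom = _
    rw [Iso.hom_inv_id_assoc]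
    rfl

instance [SymmetricCategory D] : SymmetricCategory (Induced I) :=
  SymmetricCategory.ofFaithful (toBase I)

open Functor.LaxMonoidal Functor.OplaxMonoidal in
/-- A Frobenius structure on `G.obj x` reflects along a faithful braided functor `G` as soon as its
four maps do. -/
def _root_.Hypergraph.FrobeniusStructure.ofFaithful {C : Type u₁} [Category.{v₁} C]
    [MonoidalCategory C] [BraidedCategory C] [BraidedCategory D] (G : C ⥤ D) [G.Faithful]
    [G.Braided] {x : C} (S : FrobeniusStructure (G.obj x)) (mul : x ⊗ x ⟶ x) (unit : 𝟙_ C ⟶ x)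
    (comul : x ⟶ x ⊗ x) (counit : x ⟶ 𝟙_ C)
    (hmul : G.map mul = δ G x x ≫ S.mul) (hunit : G.map unit = η G ≫ S.unit)
    (hcomul : G.map comul = S.comul ≫ μ G x x) (hcounit : G.map counit = S.counit ≫ ε G) :
    FrobeniusStructure x where
  mul := mul
  unit := unit
  comul := comul
  counit := counit
  mul_assoc := G.map_injective (by
    simp [hmul, Functor.Monoidal.map_whiskerLeft, Functor.Monoidal.map_whiskerRight, S.mul_assoc])
  unit_mul := G.map_injective (by
    simp [hmul, hunit, Functor.Monoidal.map_whiskerRight, Functor.Monoidal.map_leftUnitor,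
      ← S.unit_mul])
  mul_comm := G.map_injective (by simp [hmul, S.mul_comm])
  comul_assoc := G.map_injective (by
    simp [hcomul, Functor.Monoidal.map_whiskerLeft, Functor.Monoidal.map_whiskerRight,
      reassoc_of% S.comul_assoc])
  counit_comul := G.map_injective (by
    rw [Functor.map_comp, Functor.Monoidal.map_whiskerRight, Functor.Monoidal.map_leftUnitor_inv,
      hcomul, hcounit, ← S.counit_comul]
    simp only [Category.assoc, Functor.Monoidal.μ_δ_assoc, comp_whiskerRight])
  comul_comm := G.map_injective (by simp [hcomul, reassoc_of% S.comul_comm])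
  frobenius_left := G.map_injective (by
    simp [hmul, hcomul, Functor.Monoidal.map_whiskerLeft, Functor.Monoidal.map_whiskerRight,
      ← reassoc_of% S.frobenius_left])
  frobenius_right := G.map_injective (by
    simp [hmul, hcomul, Functor.Monoidal.map_whiskerLeft, Functor.Monoidal.map_whiskerRight,
      ← reassoc_of% S.frobenius_right])
  special := G.map_injective (by simp [hmul, hcomul, S.special])

end Induced

open Functor.LaxMonoidal Functor.OplaxMonoidal

/-- The Frobenius structure `T` on `Y` is the transport of `S` on `X` along `e : X ≅ Y`. -/
structure FrobeniusStructure.IsTransport [BraidedCategory D] {x y : D} (e : x ≅ y)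
    (S : FrobeniusStructure x) (T : FrobeniusStructure y) : Prop where
  mul : T.mul = (e.inv ⊗ₘ e.inv) ≫ S.mul ≫ e.hom
  unit : T.unit = S.unit ≫ e.hom
  comul : T.comul = e.inv ≫ S.comul ≫ (e.hom ⊗ₘ e.hom)
  counit : T.counit = e.inv ≫ S.counit

/-- The comparison isomorphisms of `I` respect the chosen Frobenius structures of `D`. -/
class InducingData.RespectsFrobenius [SymmetricCategory D] [HypergraphCategory D]
    (I : InducingData X D) : Prop where
  tensor : ∀ x y : X, FrobeniusStructure.IsTransport (I.μIso x y) (frob (I.obj x ⊗ I.obj y))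
    (frob (I.obj (I.tensor x y)))
  one : FrobeniusStructure.IsTransport I.εIso (frob (𝟙_ D)) (frob (I.obj I.one))

namespace Induced

variable (I : InducingData X D)

theorem map_tensorμ {C : Type u₁} [Category.{v₁} C] [MonoidalCategory C] [BraidedCategory C]
    [BraidedCategory D] (G : C ⥤ D) [G.Braided] (w x y z : C) :
    G.map (tensorμ w x y z) = δ G (w ⊗ x) (y ⊗ z) ≫ (δ G w x ⊗ₘ δ G y z) ≫
      tensorμ (G.obj w) (G.obj x) (G.obj y) (G.obj z) ≫ (μ G w y ⊗ₘ μ G x z) ≫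
        μ G (w ⊗ y) (x ⊗ z) := by
  rw [tensorμ_comp_μ_tensorHom_μ_comp_μ, tensorHom_comp_tensorHom_assoc]
  simp

/-- The Frobenius structures inherited from `D`. -/
instance [SymmetricCategory D] [HypergraphCategory D] [I.RespectsFrobenius] :
    HypergraphCategory (Induced I) where
  frob x := FrobeniusStructure.ofFaithful (toBase I) (frob (I.obj x))
    (ofHom I (x := I.tensor x x) ((I.μIso x x).inv ≫ (frob (I.obj x)).mul))
    (ofHom I (x := I.one) (I.εIso.inv ≫ (frob (I.obj x)).unit))
    (ofHom I (y := I.tensor x x) ((frob (I.obj x)).comul ≫ (I.μIso x x).hom))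
    (ofHom I (y := I.one) ((frob (I.obj x)).counit ≫ I.εIso.hom))
    rfl rfl rfl rfl
  mul_tensor x y := (toBase I).map_injective (by
    rw [Functor.map_comp, map_tensorμ, Functor.Monoidal.map_tensor]
    change (I.μIso _ _).inv ≫ (frob (I.obj (I.tensor x y))).mul = ((I.μIso _ _).inv ≫
      ((I.μIso _ _).inv ⊗ₘ (I.μIso _ _).inv) ≫ tensorμ (I.obj x) (I.obj y) (I.obj x) (I.obj y) ≫
      ((I.μIso _ _).hom ⊗ₘ (I.μIso _ _).hom) ≫ (I.μIso _ _).hom) ≫ (I.μIso _ _).inv ≫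
      (((I.μIso _ _).inv ≫ (frob (I.obj x)).mul) ⊗ₘ ((I.μIso _ _).inv ≫ (frob (I.obj y)).mul)) ≫
      (I.μIso _ _).hom
    rw [(InducingData.RespectsFrobenius.tensor (I := I) x y).mul, HypergraphCategory.mul_tensor]
    simp only [Category.assoc, Iso.hom_inv_id_assoc,
      MonoidalCategory.tensorHom_comp_tensorHom_assoc])
  unit_tensor x y := (toBase I).map_injective (by
    rw [Functor.map_comp, Functor.Monoidal.map_leftUnitor_inv, Functor.Monoidal.map_tensor]
    change I.εIso.inv ≫ (frob (I.obj (I.tensor x y))).unit =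
      ((λ_ (I.obj I.one)).inv ≫ I.εIso.hom ▷ I.obj I.one ≫ (I.μIso _ _).hom) ≫
      (I.μIso _ _).inv ≫
      ((I.εIso.inv ≫ (frob (I.obj x)).unit) ⊗ₘ (I.εIso.inv ≫ (frob (I.obj y)).unit)) ≫
      (I.μIso _ _).hom
    rw [(InducingData.RespectsFrobenius.tensor (I := I) x y).unit, HypergraphCategory.unit_tensor]
    have h : I.εIso.hom ▷ I.obj I.one ≫ ((I.εIso.inv ≫ (frob (I.obj x)).unit) ⊗ₘ
        (I.εIso.inv ≫ (frob (I.obj y)).unit)) =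
        (𝟙_ D) ◁ I.εIso.inv ≫ ((frob (I.obj x)).unit ⊗ₘ (frob (I.obj y)).unit) := by
      rw [← tensorHom_id, ← id_tensorHom, MonoidalCategory.tensorHom_comp_tensorHom,
        MonoidalCategory.tensorHom_comp_tensorHom, Iso.hom_inv_id_assoc, Category.id_comp,
        Category.id_comp]
    simp only [Category.assoc, Iso.hom_inv_id_assoc, reassoc_of% h,
      ← leftUnitor_inv_naturality_assoc])
  comul_tensor x y := (toBase I).map_injective (by
    rw [Functor.map_comp, map_tensorμ, Functor.Monoidal.map_tensor]
    change (frob (I.obj (I.tensor x y))).comul ≫ (I.μIso _ _).hom = ((I.μIso _ _).inv ≫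
      (((frob (I.obj x)).comul ≫ (I.μIso _ _).hom) ⊗ₘ
        ((frob (I.obj y)).comul ≫ (I.μIso _ _).hom)) ≫ (I.μIso _ _).hom) ≫ (I.μIso _ _).inv ≫
      ((I.μIso _ _).inv ⊗ₘ (I.μIso _ _).inv) ≫ tensorμ (I.obj x) (I.obj x) (I.obj y) (I.obj y) ≫
      ((I.μIso _ _).hom ⊗ₘ (I.μIso _ _).hom) ≫ (I.μIso _ _).hom
    rw [(InducingData.RespectsFrobenius.tensor (I := I) x y).comul, HypergraphCategory.comul_tensor]
    simp only [Category.assoc, Iso.hom_inv_id_assoc,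
      MonoidalCategory.tensorHom_comp_tensorHom_assoc, Iso.hom_inv_id, Category.comp_id])
  counit_tensor x y := (toBase I).map_injective (by
    rw [Functor.map_comp, Functor.Monoidal.map_leftUnitor, Functor.Monoidal.map_tensor]
    change (frob (I.obj (I.tensor x y))).counit ≫ I.εIso.hom =
      ((I.μIso _ _).inv ≫ (((frob (I.obj x)).counit ≫ I.εIso.hom) ⊗ₘ
        ((frob (I.obj y)).counit ≫ I.εIso.hom)) ≫ (I.μIso _ _).hom) ≫ (I.μIso _ _).inv ≫
      I.εIso.inv ▷ I.obj I.one ≫ (λ_ (I.obj I.one)).hom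
    rw [(InducingData.RespectsFrobenius.tensor (I := I) x y).counit,
      HypergraphCategory.counit_tensor]
    have h : (((frob (I.obj x)).counit ≫ I.εIso.hom) ⊗ₘ ((frob (I.obj y)).counit ≫ I.εIso.hom)) ≫
        I.εIso.inv ▷ I.obj I.one =
        ((frob (I.obj x)).counit ⊗ₘ (frob (I.obj y)).counit) ≫ (𝟙_ D) ◁ I.εIso.hom := by
      rw [← tensorHom_id, ← id_tensorHom, MonoidalCategory.tensorHom_comp_tensorHom,
        MonoidalCategory.tensorHom_comp_tensorHom, Category.assoc, Iso.hom_inv_id,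
        Category.comp_id, Category.comp_id]
    simp only [Category.assoc, Iso.hom_inv_id_assoc, reassoc_of% h, leftUnitor_naturality])
  unit_one := by
    change I.εIso.inv ≫ (frob (I.obj I.one)).unit = 𝟙 (I.obj I.one)
    rw [(InducingData.RespectsFrobenius.one (I := I)).unit, HypergraphCategory.unit_one]
    simp
  counit_one := by
    change (frob (I.obj I.one)).counit ≫ I.εIso.hom = 𝟙 (I.obj I.one)
    rw [(InducingData.RespectsFrobenius.one (I := I)).counit, HypergraphCategory.counit_one]
    simp

/-- The fully faithful hypergraph functor to `D`. -/
def toBaseHypergraph [SymmetricCategory D] [HypergraphCategory D] [I.RespectsFrobenius] :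
    HypergraphFunctor (Induced I) D where
  toFunctor := toBase I
  braided := inferInstance
  frob_mul x := ((I.μIso x x).hom_inv_id_assoc _).symm
  frob_unit x := (I.εIso.hom_inv_id_assoc _).symm
  frob_comul x := by
    change _ = ((frob (I.obj x)).comul ≫ (I.μIso x x).hom) ≫ (I.μIso x x).inv
    simp
    rfl
  frob_counit x := by
    change _ = ((frob (I.obj x)).counit ≫ I.εIso.hom) ≫ I.εIso.inv
    simp
    rfl

end Induced

end Induced

section Factorization

theorem id_associativity {C : Type u₁} [Category.{v₁} C] [MonoidalCategory C] (x y z : C) :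
    𝟙 (x ⊗ y) ▷ z ≫ 𝟙 ((x ⊗ y) ⊗ z) ≫ (α_ x y z).hom =
      (α_ x y z).hom ≫ x ◁ 𝟙 (y ⊗ z) ≫ 𝟙 (x ⊗ y ⊗ z) := by
  simp

theorem id_left_unitality {C : Type u₁} [Category.{v₁} C] [MonoidalCategory C] (x : C) :
    (λ_ x).hom = 𝟙 (𝟙_ C) ▷ x ≫ 𝟙 (𝟙_ C ⊗ x) ≫ (λ_ x).hom := by
  simp

theorem id_right_unitality {C : Type u₁} [Category.{v₁} C] [MonoidalCategory C] (x : C) :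
    (ρ_ x).hom = x ◁ 𝟙 (𝟙_ C) ≫ 𝟙 (x ⊗ 𝟙_ C) ≫ (ρ_ x).hom := by
  simp

open Functor.LaxMonoidal Functor.OplaxMonoidal

variable {C : Type u₁} [Category.{v₁} C] [MonoidalCategory C] [SymmetricCategory C]
  [HypergraphCategory C]
  {D : Type u₂} [Category.{v₂} D] [MonoidalCategory D] [SymmetricCategory D]
  [HypergraphCategory D]

theorem frob_one_mul : (frob (𝟙_ C)).mul = (λ_ (𝟙_ C)).hom := by
  rw [← (frob (𝟙_ C)).unit_mul, HypergraphCategory.unit_one, id_whiskerRight, Category.id_comp]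

theorem frob_one_comul : (frob (𝟙_ C)).comul = (λ_ (𝟙_ C)).inv := by
  rw [← (frob (𝟙_ C)).counit_comul, HypergraphCategory.counit_one, id_whiskerRight,
    Category.comp_id]

namespace HypergraphFunctor

variable (F : HypergraphFunctor C D)

/-- The objects, unit and product of `C`, mapped to `D` by `F`. -/
def factorData : InducingData C D where
  obj := F.obj
  tensor x y := x ⊗ y
  one := 𝟙_ C
  μIso := Functor.Monoidal.μIso F.toFunctor
  εIso := Functor.Monoidal.εIso F.toFunctor

instance : F.factorData.RespectsFrobenius where
  tensor x y := by
    constructor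
    · change (frob (F.obj (x ⊗ y))).mul = (δ F.toFunctor x y ⊗ₘ δ F.toFunctor x y) ≫
        (frob (F.obj x ⊗ F.obj y)).mul ≫ μ F.toFunctor x y
      rw [F.frob_mul, HypergraphCategory.mul_tensor, HypergraphCategory.mul_tensor, F.frob_mul,
        F.frob_mul, F.map_comp, Induced.map_tensorμ, Functor.Monoidal.map_tensor]
      simp only [Category.assoc, Functor.Monoidal.μ_δ_assoc,
        MonoidalCategory.tensorHom_comp_tensorHom_assoc]
    · change (frob (F.obj (x ⊗ y))).unit = (frob (F.obj x ⊗ F.obj y)).unit ≫ μ F.toFunctor x y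
      rw [F.frob_unit, HypergraphCategory.unit_tensor, HypergraphCategory.unit_tensor, F.frob_unit,
        F.frob_unit, F.map_comp, Functor.Monoidal.map_leftUnitor_inv, Functor.Monoidal.map_tensor]
      have h : (𝟙_ D) ◁ ε F.toFunctor ≫ ε F.toFunctor ▷ F.obj (𝟙_ C) =
        (ε F.toFunctor ⊗ₘ ε F.toFunctor) := (MonoidalCategory.tensorHom_def' _ _).symm
      simp only [Category.assoc, Functor.Monoidal.μ_δ_assoc, leftUnitor_inv_naturality_assoc,
        reassoc_of% h, MonoidalCategory.tensorHom_comp_tensorHom_assoc]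
    · change (frob (F.obj (x ⊗ y))).comul = δ F.toFunctor x y ≫
        (frob (F.obj x ⊗ F.obj y)).comul ≫ (μ F.toFunctor x y ⊗ₘ μ F.toFunctor x y)
      rw [F.frob_comul, HypergraphCategory.comul_tensor, HypergraphCategory.comul_tensor,
        F.frob_comul, F.frob_comul, F.map_comp, Induced.map_tensorμ, Functor.Monoidal.map_tensor]
      simp only [Category.assoc, Functor.Monoidal.μ_δ_assoc,
        MonoidalCategory.tensorHom_comp_tensorHom_assoc, Functor.Monoidal.μ_δ, Category.comp_id]
    · change (frob (F.obj (x ⊗ y))).counit = δ F.toFunctor x y ≫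
        (frob (F.obj x ⊗ F.obj y)).counit
      rw [F.frob_counit, HypergraphCategory.counit_tensor, HypergraphCategory.counit_tensor,
        F.frob_counit, F.frob_counit, F.map_comp, Functor.Monoidal.map_leftUnitor,
        Functor.Monoidal.map_tensor]
      have h : η F.toFunctor ▷ F.obj (𝟙_ C) ≫ (𝟙_ D) ◁ η F.toFunctor =
        (η F.toFunctor ⊗ₘ η F.toFunctor) := (MonoidalCategory.tensorHom_def _ _).symm
      simp only [Category.assoc, Functor.Monoidal.μ_δ_assoc, ← leftUnitor_naturality,
        reassoc_of% h, MonoidalCategory.tensorHom_comp_tensorHom_assoc]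
  one := by
    constructor
    · change (frob (F.obj (𝟙_ C))).mul = (η F.toFunctor ⊗ₘ η F.toFunctor) ≫
        (frob (𝟙_ D)).mul ≫ ε F.toFunctor
      rw [F.frob_mul, frob_one_mul, frob_one_mul, Functor.Monoidal.map_leftUnitor]
      rw [Functor.Monoidal.μ_δ_assoc, ← leftUnitor_naturality, MonoidalCategory.tensorHom_def,
        Category.assoc, ← MonoidalCategory.whiskerLeft_comp_assoc, Functor.Monoidal.η_ε,
        MonoidalCategory.whiskerLeft_id, Category.id_comp]
    · change (frob (F.obj (𝟙_ C))).unit = (frob (𝟙_ D)).unit ≫ ε F.toFunctor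
      rw [F.frob_unit, HypergraphCategory.unit_one, HypergraphCategory.unit_one, F.map_id,
        Category.comp_id, Category.id_comp]
    · change (frob (F.obj (𝟙_ C))).comul = η F.toFunctor ≫
        (frob (𝟙_ D)).comul ≫ (ε F.toFunctor ⊗ₘ ε F.toFunctor)
      rw [F.frob_comul, frob_one_comul, frob_one_comul, Functor.Monoidal.map_leftUnitor_inv]
      rw [Category.assoc, Category.assoc, Functor.Monoidal.μ_δ, Category.comp_id,
        leftUnitor_inv_naturality_assoc, MonoidalCategory.tensorHom_def',
        ← MonoidalCategory.whiskerLeft_comp_assoc, Functor.Monoidal.η_ε,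
        MonoidalCategory.whiskerLeft_id, Category.id_comp]
    · change (frob (F.obj (𝟙_ C))).counit = η F.toFunctor ≫ (frob (𝟙_ D)).counit
      rw [F.frob_counit, HypergraphCategory.counit_one, HypergraphCategory.counit_one, F.map_id,
        Category.comp_id, Category.id_comp]

/-- The middle category of the factorization of `F`: its objects, unit and product of objects are
those of `C`, its hom-sets are `D (F x) (F y)`, and the product of morphisms, the symmetry and
the Frobenius structures are those of `D`. -/
abbrev Factor : Type u₁ := Induced F.factorData

/-- The underlying functor of `io`. -/
def ioFunctor : C ⥤ F.Factor where
  obj x := x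
  map f := F.map f
  map_id x := F.map_id x
  map_comp f g := F.map_comp f g

/-- `ioFunctor` preserves the monoidal structure strictly. -/
def ioCoreMonoidal : F.ioFunctor.CoreMonoidal where
  εIso := Iso.refl (𝟙_ F.Factor)
  μIso x y := Iso.refl (MonoidalCategoryStruct.tensorObj (C := F.Factor) x y)
  μIso_hom_natural_left {x y} f z := by
    refine (Category.comp_id _).trans (Eq.trans ?_ (Category.id_comp _).symm)
    exact (Functor.Monoidal.map_whiskerRight F.toFunctor f z).symm
  μIso_hom_natural_right {x y} z f := by
    refine (Category.comp_id _).trans (Eq.trans ?_ (Category.id_comp _).symm)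
    exact (Functor.Monoidal.map_whiskerLeft F.toFunctor z f).symm
  associativity x y z := by
    have h : F.ioFunctor.map (α_ x y z).hom =
        (MonoidalCategoryStruct.associator (C := F.Factor) x y z).hom := by
      exact (Functor.Monoidal.map_associator F.toFunctor x y z).trans
        (Functor.Monoidal.map_associator (Induced.toBase F.factorData) x y z).symm
    rw [h]
    exact id_associativity (C := F.Factor) x y z
  left_unitality x := by
    have h : F.ioFunctor.map (λ_ x).hom =
        (MonoidalCategoryStruct.leftUnitor (C := F.Factor) x).hom := by
      exact (Functor.Monoidal.map_leftUnitor F.toFunctor x).trans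
        (Functor.Monoidal.map_leftUnitor (Induced.toBase F.factorData) x).symm
    rw [h]
    exact id_left_unitality (C := F.Factor) x
  right_unitality x := by
    have h : F.ioFunctor.map (ρ_ x).hom =
        (MonoidalCategoryStruct.rightUnitor (C := F.Factor) x).hom := by
      exact (Functor.Monoidal.map_rightUnitor F.toFunctor x).trans
        (Functor.Monoidal.map_rightUnitor (Induced.toBase F.factorData) x).symm
    rw [h]
    exact id_right_unitality (C := F.Factor) x

/-- The identity-on-objects part of the factorization. -/
def io : HypergraphFunctor C F.Factor where
  toFunctor := F.ioFunctor
  braided := {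
    F.ioCoreMonoidal.toMonoidal with
    braided x y := by
      refine (Category.id_comp _).trans (Eq.trans ?_ (Category.comp_id _).symm)
      exact Functor.map_braiding F.toFunctor x y }
  frob_mul x := by
    refine Eq.trans ?_ (Category.id_comp _).symm
    change δ F.toFunctor x x ≫ (frob (F.obj x)).mul = F.map _
    rw [F.frob_mul, Functor.Monoidal.δ_μ_assoc]
  frob_unit x := by
    refine Eq.trans ?_ (Category.id_comp _).symm
    change η F.toFunctor ≫ (frob (F.obj x)).unit = F.map _
    rw [F.frob_unit, Functor.Monoidal.η_ε_assoc]
  frob_comul x := by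
    refine Eq.trans ?_ (Category.comp_id _).symm
    change (frob (F.obj x)).comul ≫ μ F.toFunctor x x = F.map _
    rw [F.frob_comul, Category.assoc, Functor.Monoidal.δ_μ, Category.comp_id]
  frob_counit x := by
    refine Eq.trans ?_ (Category.comp_id _).symm
    change (frob (F.obj x)).counit ≫ ε F.toFunctor = F.map _
    rw [F.frob_counit, Category.assoc, Functor.Monoidal.η_ε, Category.comp_id]

/-- The fully faithful part of the factorization. -/
def ff : HypergraphFunctor F.Factor D := Induced.toBaseHypergraph F.factorData

end HypergraphFunctor

end Factorization

section ObjectwiseFree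

open Functor.LaxMonoidal Functor.OplaxMonoidal

/-- An objectwise-free hypergraph category: a strict hypergraph category together with an
isomorphism of monoids from the free monoid `List gens` to the monoid of its objects. -/
structure HypOF where
  gens : Type u
  carrier : Type u
  [category : Category.{v} carrier]
  [monoidal : MonoidalCategory carrier]
  [symmetric : SymmetricCategory carrier]
  [hypergraph : HypergraphCategory carrier]
  [strict : IsStrictMonoidal carrier]
  objEquiv : List gens ≃ carrier
  objEquiv_nil : objEquiv [] = 𝟙_ carrier
  objEquiv_append : ∀ x y : List gens, objEquiv (x ++ y) = objEquiv x ⊗ objEquiv y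

attribute [instance] HypOF.category HypOF.monoidal HypOF.symmetric HypOF.hypergraph HypOF.strict

namespace HypOF

/-- Morphisms of objectwise-free hypergraph categories: strict hypergraph functors. -/
@[ext]
structure Hom (H K : HypOF.{v, u}) where
  functor : HypergraphFunctor H.carrier K.carrier
  strict : functor.IsStrict

/-- The category of objectwise-free hypergraph categories. -/
instance : Category HypOF.{v, u} where
  Hom := Hom
  id H := ⟨HypergraphFunctor.id H.carrier, HypergraphFunctor.isStrict_id⟩
  comp F G := ⟨F.functor.comp G.functor, F.strict.comp G.strict⟩
  id_comp F := Hom.ext (HypergraphFunctor.ext_of_strict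
    (HypergraphFunctor.isStrict_id.comp F.strict) F.strict rfl)
  comp_id F := Hom.ext (HypergraphFunctor.ext_of_strict
    (F.strict.comp HypergraphFunctor.isStrict_id) F.strict rfl)
  assoc F G K := Hom.ext (HypergraphFunctor.ext_of_strict
    ((F.strict.comp G.strict).comp K.strict) (F.strict.comp (G.strict.comp K.strict)) rfl)

theorem hom_ext {H K : HypOF.{v, u}} {F G : H ⟶ K}
    (h : F.functor.toFunctor = G.functor.toFunctor) : F = G :=
  Hom.ext (HypergraphFunctor.ext_of_strict F.strict G.strict h)

variable {H K L : HypOF.{v, u}}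

/-- The map on generators, from generators of `H` to words in the generators of `K`, induced by
a morphism. -/
def genMap (F : H ⟶ K) (a : H.gens) : List K.gens :=
  K.objEquiv.symm (F.functor.obj (H.objEquiv [a]))

theorem obj_objEquiv (F : H ⟶ K) (x : List H.gens) :
    F.functor.obj (H.objEquiv x) = K.objEquiv (x.flatMap (genMap F)) := by
  induction x with
  | nil =>
    rw [List.flatMap_nil, H.objEquiv_nil, K.objEquiv_nil]
    exact F.strict.obj_unit.symm
  | cons a x ih =>
    rw [List.flatMap_cons, K.objEquiv_append, ← ih, ← List.singleton_append, H.objEquiv_append,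
      ← F.strict.obj_tensor, genMap, Equiv.apply_symm_apply]

theorem genMap_comp (F : H ⟶ K) (G : K ⟶ L) (a : H.gens) :
    genMap (F ≫ G) a = (genMap F a).flatMap (genMap G) := by
  apply L.objEquiv.injective
  rw [← obj_objEquiv]
  simp only [genMap, Equiv.apply_symm_apply]
  rfl

end HypOF

/-- The functor that sends an objectwise-free hypergraph category to its set of generators, and
a morphism to the map it induces from generators to words in generators.  The target is the
Kleisli category of the list monad. -/
def Gens : HypOF.{v, u} ⥤ KleisliCat List.{u} where
  obj H := KleisliCat.mk List H.gens
  map F := HypOF.genMap F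
  map_id H := by
    funext a
    exact H.objEquiv.symm_apply_apply [a]
  map_comp F G := by
    funext a
    exact HypOF.genMap_comp F G a

/-- A hypergraph category objectwise-free on `Λ`, with object monoid equal to `List Λ`. -/
structure HypOn (Λ : Type u) where
  [category : Category.{v} (List Λ)]
  [monoidal : MonoidalCategory (List Λ)]
  [symmetric : SymmetricCategory (List Λ)]
  [hypergraph : HypergraphCategory (List Λ)]
  [strict : IsStrictMonoidal (List Λ)]
  unit_eq : 𝟙_ (List Λ) = []
  tensor_eq : ∀ x y : List Λ, x ⊗ y = x ++ y

namespace HypOn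

variable {Λ Λ₁ Λ₂ : Type u}

/-- The underlying objectwise-free hypergraph category. -/
def toHypOF (H : HypOn.{v} Λ) : HypOF.{v, u} :=
  letI := H.category
  letI := H.monoidal
  letI := H.symmetric
  letI := H.hypergraph
  letI := H.strict
  { gens := Λ
    carrier := List Λ
    objEquiv := Equiv.refl _
    objEquiv_nil := H.unit_eq.symm
    objEquiv_append := fun x y => (H.tensor_eq x y).symm }

/-- Identity-on-objects hypergraph functors. -/
@[ext]
structure Hom (H K : HypOn.{v} Λ) where
  hom : H.toHypOF ⟶ K.toHypOF
  obj_eq : ∀ x : List Λ, hom.functor.obj x = x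

/-- The category of hypergraph categories objectwise-free on `Λ` and identity-on-objects
hypergraph functors. -/
instance categoryOn : Category.{max u v} (HypOn.{v, u} Λ) where
  Hom := Hom
  id H := ⟨𝟙 _, fun _ => rfl⟩
  comp F G := ⟨F.hom ≫ G.hom, fun x =>
    (congrArg G.hom.functor.obj (F.obj_eq x)).trans (G.obj_eq x)⟩
  id_comp F := Hom.ext (Category.id_comp F.hom)
  comp_id F := Hom.ext (Category.comp_id F.hom)
  assoc F G K := Hom.ext (Category.assoc F.hom G.hom K.hom)

end HypOn

end ObjectwiseFree

section Lift

open Functor.LaxMonoidal Functor.OplaxMonoidal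

theorem FrobeniusStructure.isTransport_eqToIso {D : Type u} [Category.{v} D] [MonoidalCategory D]
    [SymmetricCategory D] [HypergraphCategory D] {x y : D} (h : x = y) :
    FrobeniusStructure.IsTransport (eqToIso h) (frob x) (frob y) := by
  subst h
  constructor <;> simp

theorem Induced.hom_eqToHom {X : Type u₁} {D : Type u₂} [Category.{v₂} D] [MonoidalCategory D]
    (I : InducingData X D) {x y : Induced I} (h : x = y) :
    Induced.hom I (eqToHom h) = eqToHom (congrArg I.obj h) := by
  subst h
  rfl

/-- Data whose comparison isomorphisms are identities. -/
structure InducingData.IsStrict {X : Type u₁} {D : Type u₂} [Category.{v₂} D] [MonoidalCategory D]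
    (I : InducingData X D) : Prop where
  obj_tensor : ∀ x y : X, I.obj x ⊗ I.obj y = I.obj (I.tensor x y)
  obj_one : 𝟙_ D = I.obj I.one
  μ_eq : ∀ x y : X, I.μIso x y = eqToIso (obj_tensor x y)
  ε_eq : I.εIso = eqToIso obj_one
  tensor_assoc : ∀ x y z : X, I.tensor (I.tensor x y) z = I.tensor x (I.tensor y z)
  one_tensor : ∀ x : X, I.tensor I.one x = x
  tensor_one : ∀ x : X, I.tensor x I.one = x

theorem InducingData.IsStrict.associator_eq {X : Type u₁} {D : Type u₂} [Category.{v₂} D]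
    [MonoidalCategory D] [IsStrictMonoidal D] {I : InducingData X D} (h : I.IsStrict) (x y z : X) :
    ((I.μIso (I.tensor x y) z).inv ≫ ((I.μIso x y).inv ⊗ₘ 𝟙 (I.obj z))) ≫
      (α_ (I.obj x) (I.obj y) (I.obj z)).hom ≫ (𝟙 (I.obj x) ⊗ₘ (I.μIso y z).hom) ≫
        (I.μIso x (I.tensor y z)).hom = eqToHom (congrArg I.obj (h.tensor_assoc x y z)) := by
  rw [IsStrictMonoidal.associator_hom, h.μ_eq, h.μ_eq, h.μ_eq, h.μ_eq]
  simp

theorem InducingData.IsStrict.leftUnitor_eq {X : Type u₁} {D : Type u₂} [Category.{v₂} D]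
    [MonoidalCategory D] [IsStrictMonoidal D] {I : InducingData X D} (h : I.IsStrict) (x : X) :
    ((I.μIso I.one x).inv ≫ (I.εIso.inv ⊗ₘ 𝟙 (I.obj x))) ≫ (λ_ (I.obj x)).hom =
      eqToHom (congrArg I.obj (h.one_tensor x)) := by
  rw [IsStrictMonoidal.leftUnitor_hom, h.μ_eq, h.ε_eq]
  simp

theorem InducingData.IsStrict.rightUnitor_eq {X : Type u₁} {D : Type u₂} [Category.{v₂} D]
    [MonoidalCategory D] [IsStrictMonoidal D] {I : InducingData X D} (h : I.IsStrict) (x : X) :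
    ((I.μIso x I.one).inv ≫ (𝟙 (I.obj x) ⊗ₘ I.εIso.inv)) ≫ (ρ_ (I.obj x)).hom =
      eqToHom (congrArg I.obj (h.tensor_one x)) := by
  rw [IsStrictMonoidal.rightUnitor_hom, h.μ_eq, h.ε_eq]
  simp

theorem InducingData.IsStrict.isStrictMonoidal {X : Type u₁} {D : Type u₂} [Category.{v₂} D]
    [MonoidalCategory D] [IsStrictMonoidal D] {I : InducingData X D} (h : I.IsStrict) :
    IsStrictMonoidal (Induced I) where
  tensor_assoc := h.tensor_assoc
  unit_tensor := h.one_tensor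
  tensor_unit := h.tensor_one
  associator_hom x y z :=
    (h.associator_eq x y z).trans (Induced.hom_eqToHom I (h.tensor_assoc x y z)).symm
  leftUnitor_hom x := (h.leftUnitor_eq x).trans (Induced.hom_eqToHom I (h.one_tensor x)).symm
  rightUnitor_hom x := (h.rightUnitor_eq x).trans (Induced.hom_eqToHom I (h.tensor_one x)).symm

theorem InducingData.IsStrict.respectsFrobenius {X : Type u₁} {D : Type u₂} [Category.{v₂} D]
    [MonoidalCategory D] [SymmetricCategory D] [HypergraphCategory D] {I : InducingData X D}
    (h : I.IsStrict) : I.RespectsFrobenius where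
  tensor x y := by
    rw [h.μ_eq]
    exact FrobeniusStructure.isTransport_eqToIso _
  one := by
    rw [h.ε_eq]
    exact FrobeniusStructure.isTransport_eqToIso _

theorem InducingData.IsStrict.isStrict_toBase {X : Type u₁} {D : Type u₂} [Category.{v₂} D]
    [MonoidalCategory D] [SymmetricCategory D] [HypergraphCategory D] {I : InducingData X D}
    (h : I.IsStrict) [I.RespectsFrobenius] : (Induced.toBaseHypergraph I).IsStrict where
  obj_unit := h.obj_one
  obj_tensor := h.obj_tensor
  ε_eq := congrArg Iso.hom h.ε_eq
  μ_eq x y := congrArg Iso.hom (h.μ_eq x y)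

namespace HypOF

variable {Λ : Type u} (H : HypOF.{v, u})

/-- A word in `Λ` is sent to the product in `H` of the words that `g` assigns to its letters. -/
def liftData (g : Λ → List H.gens) : InducingData (List Λ) H.carrier where
  obj x := H.objEquiv (x.flatMap g)
  tensor x y := x ++ y
  one := []
  μIso x y := eqToIso (by rw [List.flatMap_append, H.objEquiv_append])
  εIso := eqToIso (by rw [List.flatMap_nil, H.objEquiv_nil])

theorem isStrict_liftData (g : Λ → List H.gens) : (H.liftData g).IsStrict where
  obj_tensor _ _ := by simp only [liftData, List.flatMap_append, H.objEquiv_append]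
  obj_one := by simp only [liftData, List.flatMap_nil, H.objEquiv_nil]
  μ_eq _ _ := rfl
  ε_eq := rfl
  tensor_assoc := List.append_assoc
  one_tensor := List.nil_append
  tensor_one := List.append_nil

instance (g : Λ → List H.gens) : (H.liftData g).RespectsFrobenius :=
  (H.isStrict_liftData g).respectsFrobenius

/-- The chosen domain of the lift of `g` with codomain `H`: objects are words in `Λ`, the hom-sets
are those of `H` between the images of words under `g`, and all structure on morphisms is that
of `H`. -/
def pull (g : Λ → List H.gens) : HypOn.{v} Λ where
  category := inferInstanceAs (Category (Induced (H.liftData g)))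
  monoidal := inferInstanceAs (MonoidalCategory (Induced (H.liftData g)))
  symmetric := inferInstanceAs (SymmetricCategory (Induced (H.liftData g)))
  hypergraph := inferInstanceAs (HypergraphCategory (Induced (H.liftData g)))
  strict := (H.isStrict_liftData g).isStrictMonoidal
  unit_eq := rfl
  tensor_eq _ _ := rfl

/-- The chosen lift of `g` with codomain `H`: the fully faithful functor to `H`. -/
def lift (g : Λ → List H.gens) : (H.pull g).toHypOF ⟶ H where
  functor := Induced.toBaseHypergraph (H.liftData g)
  strict := (H.isStrict_liftData g).isStrict_toBase

instance (g : Λ → List H.gens) : (H.lift g).functor.Full :=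
  inferInstanceAs (Induced.toBase (H.liftData g)).Full

instance (g : Λ → List H.gens) : (H.lift g).functor.Faithful :=
  inferInstanceAs (Induced.toBase (H.liftData g)).Faithful

variable {H} {K : HypOF.{v, u}} (F : H ⟶ K)

theorem isStrict_factorData : F.functor.factorData.IsStrict where
  obj_tensor := F.strict.obj_tensor
  obj_one := F.strict.obj_unit
  μ_eq x y := Iso.ext (F.strict.μ_eq x y)
  ε_eq := Iso.ext F.strict.ε_eq
  tensor_assoc := IsStrictMonoidal.tensor_assoc
  one_tensor := IsStrictMonoidal.unit_tensor
  tensor_one := IsStrictMonoidal.tensor_unit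

/-- The middle object of the factorization of a morphism. -/
def mid : HypOF.{v, u} where
  gens := H.gens
  carrier := F.functor.Factor
  strict := (isStrict_factorData F).isStrictMonoidal
  objEquiv := H.objEquiv
  objEquiv_nil := H.objEquiv_nil
  objEquiv_append := H.objEquiv_append

/-- The identity-on-objects part of a morphism. -/
def ioPart : H ⟶ mid F where
  functor := F.functor.io
  strict := { obj_unit := rfl, obj_tensor := fun _ _ => rfl, ε_eq := rfl, μ_eq := fun _ _ => rfl }

/-- The fully faithful part of a morphism. -/
def ffPart : mid F ⟶ K where
  functor := F.functor.ff
  strict := (isStrict_factorData F).isStrict_toBase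

end HypOF

end Lift

section Fill

open Functor.LaxMonoidal Functor.OplaxMonoidal

variable {C : Type u₁} [Category.{v₁} C] [MonoidalCategory C] [SymmetricCategory C]
  [HypergraphCategory C]
  {D : Type u₂} [Category.{v₂} D] [MonoidalCategory D] [SymmetricCategory D]
  [HypergraphCategory D]
  {E : Type u₃} [Category.{v₃} E] [MonoidalCategory E] [SymmetricCategory E]
  [HypergraphCategory E]

/-- If `F ⋙ G` is isomorphic to a monoidal functor and `G` is monoidal and fully faithful, then
`F` is monoidal. -/
noncomputable def coreMonoidalOfComp (G : E ⥤ D) [G.Monoidal] [G.Full] [G.Faithful] (F : C ⥤ E)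
    [(F ⋙ G).Monoidal] : F.CoreMonoidal where
  εIso := G.preimageIso ((Functor.Monoidal.εIso G).symm ≪≫ Functor.Monoidal.εIso (F ⋙ G))
  μIso x y := G.preimageIso ((Functor.Monoidal.μIso G (F.obj x) (F.obj y)).symm ≪≫
    Functor.Monoidal.μIso (F ⋙ G) x y)
  μIso_hom_natural_left {x y} f z := G.map_injective (by
    have h := Functor.LaxMonoidal.μ_natural_left (F ⋙ G) f z
    dsimp only [Functor.comp_obj, Functor.comp_map] at h
    simp only [Functor.map_comp, Functor.Monoidal.map_whiskerRight G, Functor.preimageIso_hom,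
      Functor.map_preimage, Iso.trans_hom, Iso.symm_hom, Functor.Monoidal.μIso_inv,
      Functor.Monoidal.μIso_hom, Category.assoc, Functor.Monoidal.μ_δ_assoc, ← h])
  μIso_hom_natural_right {x y} z f := G.map_injective (by
    have h := Functor.LaxMonoidal.μ_natural_right (F ⋙ G) z f
    dsimp only [Functor.comp_obj, Functor.comp_map] at h
    simp only [Functor.map_comp, Functor.Monoidal.map_whiskerLeft G, Functor.preimageIso_hom,
      Functor.map_preimage, Iso.trans_hom, Iso.symm_hom, Functor.Monoidal.μIso_inv,
      Functor.Monoidal.μIso_hom, Category.assoc, Functor.Monoidal.μ_δ_assoc, ← h])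
  associativity x y z := G.map_injective (by
    have h := Functor.LaxMonoidal.associativity (F ⋙ G) x y z
    dsimp only [Functor.comp_obj, Functor.comp_map] at h
    simp only [Functor.map_comp, Functor.Monoidal.map_whiskerLeft G,
      Functor.Monoidal.map_whiskerRight G, Functor.Monoidal.map_associator G,
      Functor.preimageIso_hom, Functor.map_preimage, Iso.trans_hom, Iso.symm_hom,
      Functor.Monoidal.μIso_inv, Functor.Monoidal.μIso_hom, Category.assoc,
      Functor.Monoidal.μ_δ_assoc, comp_whiskerRight, MonoidalCategory.whiskerLeft_comp]
    rw [← comp_whiskerRight_assoc, ← MonoidalCategory.whiskerLeft_comp_assoc]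
    simp [h])
  left_unitality x := G.map_injective (by
    have h := Functor.LaxMonoidal.left_unitality (F ⋙ G) x
    dsimp only [Functor.comp_obj, Functor.comp_map] at h
    simp [Functor.Monoidal.map_whiskerRight, Functor.Monoidal.map_leftUnitor, h])
  right_unitality x := G.map_injective (by
    have h := Functor.LaxMonoidal.right_unitality (F ⋙ G) x
    dsimp only [Functor.comp_obj, Functor.comp_map] at h
    simp [Functor.Monoidal.map_whiskerLeft, Functor.Monoidal.map_rightUnitor, h])

namespace HypergraphFunctor

variable (G : HypergraphFunctor E D) [G.toFunctor.Full] [G.toFunctor.Faithful] (F : C ⥤ E)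
  (K : HypergraphFunctor C D) (i : K.toFunctor ≅ F ⋙ G.toFunctor)

/-- The monoidal structure on `F` induced by `i`. -/
noncomputable def fillMonoidal : F.Monoidal :=
  letI : (F ⋙ G.toFunctor).Monoidal := Functor.Monoidal.transport i
  (coreMonoidalOfComp G.toFunctor F).toMonoidal

theorem map_fill_μ (x y : C) : letI := fillMonoidal G F K i
    G.map (μ F x y) = δ G.toFunctor (F.obj x) (F.obj y) ≫ (i.inv.app x ⊗ₘ i.inv.app y) ≫
      μ K.toFunctor x y ≫ i.hom.app (x ⊗ y) :=
  G.map_preimage _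

theorem map_fill_ε : letI := fillMonoidal G F K i
    G.map (ε F) = η G.toFunctor ≫ ε K.toFunctor ≫ i.hom.app (𝟙_ C) :=
  G.map_preimage _

theorem map_fill_δ (x y : C) : letI := fillMonoidal G F K i
    G.map (δ F x y) = i.inv.app (x ⊗ y) ≫ δ K.toFunctor x y ≫ (i.hom.app x ⊗ₘ i.hom.app y) ≫
      μ G.toFunctor (F.obj x) (F.obj y) := by
  letI := fillMonoidal G F K i
  rw [← cancel_epi (G.map (μ F x y)), ← G.map_comp, Functor.Monoidal.μ_δ, G.map_id, map_fill_μ]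
  simp

theorem map_fill_η : letI := fillMonoidal G F K i
    G.map (η F) = i.inv.app (𝟙_ C) ≫ η K.toFunctor ≫ ε G.toFunctor := by
  letI := fillMonoidal G F K i
  rw [← cancel_epi (G.map (ε F)), ← G.map_comp, Functor.Monoidal.ε_η, G.map_id, map_fill_ε]
  simp

/-- A functor whose composite with a fully faithful hypergraph functor is isomorphic to a hypergraph
functor, by an isomorphism that respects the Frobenius structures, is a hypergraph functor. -/
noncomputable def fill (hi : ∀ x : C, FrobeniusStructure.IsTransport (i.app x)
    (frob (K.obj x)) (frob (G.obj (F.obj x)))) : HypergraphFunctor C E where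
  toFunctor := F
  braided := {
    fillMonoidal G F K i with
    braided x y := G.map_injective (by
      letI := fillMonoidal G F K i
      have h := Functor.Braided.braided (F := K.toFunctor) x y
      have n := i.hom.naturality (β_ x y).hom
      dsimp only [Functor.comp_obj, Functor.comp_map] at n
      rw [G.map_comp, G.map_comp, map_fill_μ, map_fill_μ, Functor.map_braiding G.toFunctor]
      simp only [Category.assoc, Functor.Monoidal.μ_δ_assoc, ← n, reassoc_of% h]
      rw [← BraidedCategory.braiding_naturality_assoc]) }
  frob_mul x := G.map_injective (by
    letI := fillMonoidal G F K i
    have n := i.hom.naturality (frob x).mul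
    dsimp only [Functor.comp_obj, Functor.comp_map] at n
    have h := (hi x).mul
    rw [G.frob_mul, K.frob_mul] at h
    rw [← cancel_epi (μ G.toFunctor _ _), h, G.map_comp, map_fill_μ]
    simp [n])
  frob_unit x := G.map_injective (by
    letI := fillMonoidal G F K i
    have n := i.hom.naturality (frob x).unit
    dsimp only [Functor.comp_obj, Functor.comp_map] at n
    have h := (hi x).unit
    rw [G.frob_unit, K.frob_unit] at h
    rw [← cancel_epi (ε G.toFunctor), h, G.map_comp, map_fill_ε]
    simp [n])
  frob_comul x := G.map_injective (by
    letI := fillMonoidal G F K i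
    have n := i.inv.naturality (frob x).comul
    dsimp only [Functor.comp_obj, Functor.comp_map] at n
    have h := (hi x).comul
    rw [G.frob_comul, K.frob_comul] at h
    rw [← cancel_mono (δ G.toFunctor _ _), h, G.map_comp, map_fill_δ]
    simp [reassoc_of% n])
  frob_counit x := G.map_injective (by
    letI := fillMonoidal G F K i
    have n := i.inv.naturality (frob x).counit
    dsimp only [Functor.comp_obj, Functor.comp_map] at n
    have h := (hi x).counit
    rw [G.frob_counit, K.frob_counit] at h
    rw [← cancel_mono (η G.toFunctor), h, G.map_comp, map_fill_η]
    simp [reassoc_of% n])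

end HypergraphFunctor

end Fill

section FillOF

open Functor.LaxMonoidal Functor.OplaxMonoidal

theorem HypergraphFunctor.functor_ext_of_faithful {C : Type u₁} [Category.{v₁} C] {D : Type u₂}
    [Category.{v₂} D] {E : Type u₃} [Category.{v₃} E] (G : E ⥤ D) [G.Faithful] {F F' : C ⥤ E}
    (h : ∀ x, F.obj x = F'.obj x) (h' : F ⋙ G = F' ⋙ G) : F = F' := by
  refine CategoryTheory.Functor.ext h fun x y f => G.map_injective ?_
  have e := Functor.congr_hom h' f
  dsimp only [Functor.comp_map] at e
  rw [e, G.map_comp, G.map_comp, eqToHom_map, eqToHom_map]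

theorem eqToHom_comp₃ {C : Type u} [Category.{v} C] {a b c d : C} (p : a = b) (q : b = c)
    (r : c = d) : eqToHom p ≫ eqToHom q ≫ eqToHom r = eqToHom (p.trans (q.trans r)) := by
  subst p q r
  simp

theorem eqToHom_comp_tensor {C : Type u} [Category.{v} C] [MonoidalCategory C]
    {x a b a' b' c d : C} (p : x = a ⊗ b) (q : a = a') (q' : b = b') (r : a' ⊗ b' = c)
    (s : c = d) : eqToHom p ≫ (eqToHom q ⊗ₘ eqToHom q') ≫ eqToHom r ≫ eqToHom s =
      eqToHom (by rw [p, q, q', r, s]) := by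
  subst p q q' r s
  simp

namespace HypOF

variable {H L : HypOF.{v, u}} {Λ : Type u}

theorem hom_ext_of_lift {g : Λ → List L.gens} {F F' : H ⟶ (L.pull g).toHypOF}
    (h : genMap F = genMap F') (h' : F ≫ L.lift g = F' ≫ L.lift g) : F = F' := by
  refine hom_ext (HypergraphFunctor.functor_ext_of_faithful (L.lift g).functor.toFunctor ?_
    (congrArg (fun K => K.functor.toFunctor) h'))
  intro x
  obtain ⟨x, rfl⟩ := H.objEquiv.surjective x
  rw [obj_objEquiv, obj_objEquiv, h]

variable (K : H ⟶ L) (f : H.gens → List Λ) (g : Λ → List L.gens)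
  (w : ∀ a, genMap K a = (f a).flatMap g)

theorem fill_obj (K : H ⟶ L) (f : H.gens → List Λ) (g : Λ → List L.gens)
    (w : ∀ a, genMap K a = (f a).flatMap g) (x : H.carrier) :
    K.functor.obj x = L.objEquiv (((H.objEquiv.symm x).flatMap f).flatMap g) := by
  obtain ⟨x, rfl⟩ := H.objEquiv.surjective x
  rw [obj_objEquiv, Equiv.symm_apply_apply, List.flatMap_assoc]
  congr 2
  exact funext w

/-- The functor underlying `fill`. -/
def fillFunctor : H.carrier ⥤ (L.pull g).toHypOF.carrier where
  obj x := (H.objEquiv.symm x).flatMap f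
  map {x y} k := Induced.ofHom (L.liftData g) (x := (H.objEquiv.symm x).flatMap f)
    (y := (H.objEquiv.symm y).flatMap f)
    (eqToHom (fill_obj K f g w x).symm ≫ K.functor.map k ≫ eqToHom (fill_obj K f g w y))
  map_id x := (L.lift g).functor.map_injective (by
    change eqToHom _ ≫ K.functor.map (𝟙 x) ≫ eqToHom _ = 𝟙 (L.objEquiv _)
    rw [K.functor.map_id, Category.id_comp, eqToHom_trans]
    rfl)
  map_comp {x y z} k l := (L.lift g).functor.map_injective (by
    change eqToHom _ ≫ K.functor.map (k ≫ l) ≫ eqToHom _ = (eqToHom _ ≫ K.functor.map k ≫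
      eqToHom (fill_obj K f g w y)) ≫ (eqToHom _ ≫ K.functor.map l ≫ eqToHom _)
    simp)

/-- `K` is the composite of `fillFunctor` with the lift of `g`, up to equality of objects. -/
def fillIso : K.functor.toFunctor ≅ fillFunctor K f g w ⋙ (L.lift g).functor.toFunctor :=
  NatIso.ofComponents (fun x => eqToIso (fill_obj K f g w x)) (fun {x y} k => by
    change K.functor.map k ≫ eqToHom (fill_obj K f g w y) = eqToHom (fill_obj K f g w x) ≫
      eqToHom (fill_obj K f g w x).symm ≫ K.functor.map k ≫ eqToHom (fill_obj K f g w y)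
    simp)

theorem fillFunctor_unit : (fillFunctor K f g w).obj (𝟙_ _) =
    𝟙_ (L.pull g).toHypOF.carrier := by
  change (H.objEquiv.symm (𝟙_ _)).flatMap f = List.nil
  rw [← H.objEquiv_nil, Equiv.symm_apply_apply, List.flatMap_nil]

theorem fillFunctor_tensor (x y : H.carrier) : (fillFunctor K f g w).obj (x ⊗ y) =
    (fillFunctor K f g w).obj x ⊗ (fillFunctor K f g w).obj y := by
  obtain ⟨x, rfl⟩ := H.objEquiv.surjective x
  obtain ⟨y, rfl⟩ := H.objEquiv.surjective y
  change (H.objEquiv.symm (_ ⊗ _)).flatMap f =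
    List.append ((H.objEquiv.symm _).flatMap f) ((H.objEquiv.symm _).flatMap f)
  rw [← H.objEquiv_append, Equiv.symm_apply_apply, Equiv.symm_apply_apply, Equiv.symm_apply_apply,
    List.flatMap_append]
  rfl

/-- The factorization of a morphism through the lift of `g`. -/
noncomputable def fill : H ⟶ (L.pull g).toHypOF where
  functor := HypergraphFunctor.fill (L.lift g).functor (fillFunctor K f g w) K.functor
    (fillIso K f g w) (fun x => FrobeniusStructure.isTransport_eqToIso (fill_obj K f g w x))
  strict := {
    obj_unit := (fillFunctor_unit K f g w).symm
    obj_tensor := fun x y => (fillFunctor_tensor K f g w x y).symm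
    ε_eq := (L.lift g).functor.map_injective (by
      refine (HypergraphFunctor.map_fill_ε _ _ _ (fillIso K f g w)).trans ?_
      refine Eq.trans ?_ (eqToHom_map (L.lift g).functor.toFunctor _).symm
      rw [K.strict.ε_eq]
      exact eqToHom_comp₃ (L.isStrict_liftData g).obj_one.symm _ (fill_obj K f g w (𝟙_ _)))
    μ_eq := fun x y => (L.lift g).functor.map_injective (by
      refine (HypergraphFunctor.map_fill_μ _ _ _ (fillIso K f g w) x y).trans ?_
      refine Eq.trans ?_ (eqToHom_map (L.lift g).functor.toFunctor _).symm
      rw [K.strict.μ_eq]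
      exact eqToHom_comp_tensor ((L.isStrict_liftData g).obj_tensor _ _).symm
        (fill_obj K f g w x).symm (fill_obj K f g w y).symm _ (fill_obj K f g w (x ⊗ y))) }

theorem fill_lift : fill K f g w ≫ L.lift g = K := by
  refine hom_ext (CategoryTheory.Functor.ext (fun x => (fill_obj K f g w x).symm) ?_)
  intro x y k
  rfl

theorem genMap_fill : genMap (fill K f g w) = f := by
  funext a
  change (H.objEquiv.symm (H.objEquiv [a])).flatMap f = f a
  rw [Equiv.symm_apply_apply, List.flatMap_singleton]

end HypOF

end FillOF

section Fibration

/-- A choice, for a functor `p : E ⥤ B`, of a morphism into `e` for every `g : b ⟶ p.obj e`. -/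
structure LiftChoice {E : Type u₁} [Category.{v₁} E] {B : Type u₂} [Category.{v₂} B]
    (p : E ⥤ B) where
  dom {e : E} {b : B} (g : b ⟶ p.obj e) : E
  lift {e : E} {b : B} (g : b ⟶ p.obj e) : dom g ⟶ e

namespace LiftChoice

variable {E : Type u₁} [Category.{v₁} E] {B : Type u₂} [Category.{v₂} B] {p : E ⥤ B}
  (c : LiftChoice p)

/-- The chosen morphisms form a cleavage: the morphism chosen for `g` is cartesian over `g`. -/
def IsCleavage : Prop :=
  ∀ ⦃e : E⦄ ⦃b : B⦄ (g : b ⟶ p.obj e), p.IsStronglyCartesian g (c.lift g)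

/-- The chosen morphisms are closed under composition: the composite of the morphism chosen for `f`
and the one chosen for `g` is the one chosen for the composite of `f` and `g`, on the nose. -/
def CompClosed : Prop :=
  ∀ ⦃e : E⦄ ⦃b b' : B⦄ (g : b ⟶ p.obj e) (f : b' ⟶ p.obj (c.dom g)),
    ∃ h : c.dom (f ≫ p.map (c.lift g)) = c.dom f,
      c.lift (f ≫ p.map (c.lift g)) = eqToHom h ≫ c.lift f ≫ c.lift g

/-- The morphisms chosen for identities are identities. -/
def IdClosed : Prop :=
  ∀ e : E, ∃ h : c.dom (𝟙 (p.obj e)) = e, c.lift (𝟙 (p.obj e)) = eqToHom h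

end LiftChoice

/-- The chosen lifts for `Gens`. -/
def gensLifts : LiftChoice Gens.{v, u} where
  dom {H _} g := (H.pull g).toHypOF
  lift {H _} g := H.lift g

/-- The objectwise-free hypergraph categories whose monoid of objects is literally the free monoid
`List Λ` on their generators. -/
def isListed : ObjectProperty HypOF.{v, u} :=
  fun H => ∃ (Λ : Type u) (A : HypOn.{v} Λ), A.toHypOF = H

/-- The chosen lifts, for the restriction of `Gens` to the categories with object monoid `List Λ`. -/
def gensLiftsListed : LiftChoice (isListed.{v, u}.ι ⋙ Gens.{v, u}) where
  dom {H _} g := ⟨(H.obj.pull g).toHypOF, _, _, rfl⟩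
  lift {H _} g := ObjectProperty.homMk (H.obj.lift g)

theorem HypOn.hom_ext {Λ : Type u} {H K : HypOn.{v} Λ} {F G : H ⟶ K} (h : F.hom = G.hom) : F = G :=
  HypOn.Hom.ext h

theorem HypOn.genMap_hom {Λ : Type u} {H K : HypOn.{v} Λ} (F : H ⟶ K) :
    HypOF.genMap F.hom = pure :=
  funext fun a => F.obj_eq [a]

/-- The factorization through the lift for `K` of the lift for `H` followed by `F`. -/
noncomputable def HypOn.pullMap {Λ₁ Λ₂ : Type u} (g : Λ₁ → List Λ₂) {H K : HypOn.{v} Λ₂}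
    (F : H ⟶ K) : H.toHypOF.pull g ⟶ K.toHypOF.pull g where
  hom := HypOF.fill (L := K.toHypOF) (H.toHypOF.lift g ≫ F.hom) pure g (fun a => by
    refine (F.obj_eq _).trans ?_
    change [a].flatMap g = [a].flatMap g
    rfl)
  obj_eq x := List.flatMap_pure_eq_map _ _ |>.trans (List.map_id x)

theorem HypOn.pullMap_lift {Λ₁ Λ₂ : Type u} (g : Λ₁ → List Λ₂) {H K : HypOn.{v} Λ₂} (F : H ⟶ K) :
    (HypOn.pullMap g F).hom ≫ K.toHypOF.lift g = H.toHypOF.lift g ≫ F.hom :=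
  HypOF.fill_lift _ _ _ _

theorem HypOn.hom_ext_of_lift {Λ₁ Λ₂ : Type u} (g : Λ₁ → List Λ₂) {A : HypOn.{v} Λ₁}
    {K : HypOn.{v} Λ₂} {F F' : A ⟶ K.toHypOF.pull g}
    (h : F.hom ≫ K.toHypOF.lift g = F'.hom ≫ K.toHypOF.lift g) : F = F' :=
  HypOn.hom_ext (HypOF.hom_ext_of_lift ((HypOn.genMap_hom F).trans (HypOn.genMap_hom F').symm) h)

/-- The functor between the categories of hypergraph categories objectwise-free on `Λ₂` and on `Λ₁`
that is induced by a morphism `g : Λ₁ ⟶ Λ₂` of the Kleisli category. -/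
noncomputable def HypOn.pullFunctor {Λ₁ Λ₂ : Type u} (g : Λ₁ → List Λ₂) :
    HypOn.{v, u} Λ₂ ⥤ HypOn.{v, u} Λ₁ where
  obj H := H.toHypOF.pull g
  map F := HypOn.pullMap g F
  map_id H := HypOn.hom_ext_of_lift g (by
    rw [HypOn.pullMap_lift]
    exact (Category.comp_id _).trans (Category.id_comp _).symm)
  map_comp {H K L} F G := HypOn.hom_ext_of_lift g (by
    refine (HypOn.pullMap_lift g (F ≫ G)).trans ?_
    refine Eq.trans ?_ (Category.assoc _ _ _).symm
    rw [HypOn.pullMap_lift, ← Category.assoc, HypOn.pullMap_lift, Category.assoc]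
    rfl)

/-- `pullFunctor` preserves the identities and the composition of the Kleisli category of the list
monad on the nose. -/
structure HypOn.PullFunctorial : Prop where
  map_id : ∀ Λ : Type u, HypOn.pullFunctor.{v, u} (fun a : Λ => [a]) = 𝟭 (HypOn.{v, u} Λ)
  map_comp : ∀ {Λ₁ Λ₂ Λ₃ : Type u} (f : Λ₁ → List Λ₂) (g : Λ₂ → List Λ₃),
    HypOn.pullFunctor.{v, u} (fun a => (f a).flatMap g) =
      HypOn.pullFunctor g ⋙ HypOn.pullFunctor f

open Opposite

/-- The category `HypOn Λ`, as an object of `Cat`. -/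
def fiberCat (Λ : Type u) : Cat.{max u v, max u (v + 1)} :=
  Cat.of (HypOn.{v, u} Λ)

/-- The functor `pullFunctor g`, as a morphism of `Cat`. -/
noncomputable def fiberHom {Λ₁ Λ₂ : Type u} (g : Λ₁ → List Λ₂) :
    fiberCat.{v, u} Λ₂ ⟶ fiberCat.{v, u} Λ₁ :=
  (HypOn.pullFunctor.{v, u} g).toCatHom

theorem HypOn.PullFunctorial.fiberHom_id (h : HypOn.PullFunctorial.{v, u}) (Λ : Type u) :
    fiberHom.{v, u} (fun a : Λ => [a]) = 𝟙 (fiberCat.{v, u} Λ) :=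
  congrArg Functor.toCatHom (h.map_id Λ)

theorem HypOn.PullFunctorial.fiberHom_comp (h : HypOn.PullFunctorial.{v, u}) {Λ₁ Λ₂ Λ₃ : Type u}
    (f : Λ₁ → List Λ₂) (g : Λ₂ → List Λ₃) :
    fiberHom.{v, u} (fun a => (f a).flatMap g) = fiberHom g ≫ fiberHom f :=
  congrArg Functor.toCatHom (h.map_comp f g)

/-- The functor `Λ ↦ HypOn Λ`. -/
noncomputable def fiberFunctor (h : HypOn.PullFunctorial.{v, u}) :
    (KleisliCat List.{u})ᵒᵖ ⥤ Cat.{max u v, max u (v + 1)} where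
  obj Λ := fiberCat.{v, u} Λ.unop
  map g := fiberHom.{v, u} g.unop
  map_id Λ := h.fiberHom_id Λ.unop
  map_comp f g := h.fiberHom_comp g.unop f.unop

/-- The Grothendieck construction of `Λ ↦ HypOn Λ`: objects are pairs of `Λ` and `A : HypOn Λ`, a
morphism `(Λ, A) ⟶ (Λ', A')` is a pair of `f : Λ ⟶ Λ'` and `A ⟶ (pullFunctor f).obj A'`. -/
abbrev TotalOF (h : HypOn.PullFunctorial.{v, u}) : Type (max (u + 1) (v + 1)) :=
  Pseudofunctor.CoGrothendieck (fiberFunctor h).toPseudofunctor'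

namespace TotalOF

variable {h : HypOn.PullFunctorial.{v, u}}

/-- The objectwise-free hypergraph category that an object `(Λ, A)` consists of. -/
def toHypOF (X : TotalOF.{v, u} h) : HypOF.{v, u} :=
  HypOn.toHypOF (Λ := X.base) X.fiber

/-- The hypergraph functor of a morphism `(f, k)`: the composite of `k` and of the lift of `f`. -/
noncomputable def toHom {X Y : TotalOF.{v, u} h} (k : X ⟶ Y) : toHypOF X ⟶ toHypOF Y :=
  HypOn.Hom.hom (Λ := X.base) k.fiber ≫ HypOF.lift (toHypOF Y) k.base

end TotalOF

end Fibration

end Hypergraph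

/-!
The theorem rests on two facts about strict hypergraph functors between objectwise-free hypergraph
categories.

*Fully faithful implies cartesian* (`HypOF.isStronglyCartesian_of_fullyFaithful`). Let `G : E ⟶ L`
be fully faithful, let `K : H ⟶ L`, and suppose that on generators `K` factors through `G` by a
map `f` from the generators of `H` to words in those of `E`. As the objects of `H` are freely
generated, `f` determines a factorization on objects, and `G` being fully faithful, there is
exactly one factorization on morphisms. It is strict monoidal and preserves the Frobenius
structures since `G` reflects equality of morphisms. Both the chosen lifts and the fully faithful
part of a factorization are fully faithful, so that they are cartesian. A lift of an identity is
then cartesian over an isomorphism, hence an isomorphism (`HypOF.isIso_lift_pure`); this gives the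
essential surjectivity of the inclusion of the categories with object monoid `List Λ`, and of the
functor from the Grothendieck construction.

*Equality on the nose* (`HypOn.eq_of_hom`). Let `A` and `B` be two hypergraph categories with
object monoid `List Λ` and with equal hom-types. If there is a strict hypergraph functor from `A`
to `B` that is the identity on objects and on morphisms, then `A` and `B` are equal: preservation
of each piece of structure by the identity is the equality of the two structures. The hom-types of
the various pullbacks and middle categories are hom-types of one category between equal objects,
so this applies to the comparison functor from any of them to a chosen pullback (`HypOF.eq_pull`).
The closure of the lifts under composition and identities, the identification of the middle
category of a factorization with a pullback, and the strict functoriality of `pullFunctor` are all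
instances of this.

The functor from the Grothendieck construction is fully faithful because a morphism `F`
corresponds to the pair of its map on generators and of its factorization through the lift of that
map.
-/

namespace Hypergraph

open Functor.LaxMonoidal Functor.OplaxMonoidal

/-! ### The factorization of a hypergraph functor -/

/-- Hypergraph functors are determined by their underlying functor and their coherence maps. -/
theorem HypergraphFunctor.ext_of_coherence {C : Type u₁} [Category.{v₁} C] [MonoidalCategory C]
    [SymmetricCategory C] [HypergraphCategory C] {D : Type u₂} [Category.{v₂} D]
    [MonoidalCategory D] [SymmetricCategory D] [HypergraphCategory D]
    {F G : HypergraphFunctor C D} (h : F.toFunctor = G.toFunctor)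
    (hε : ε F.toFunctor ≍ ε G.toFunctor) (hμ : ∀ x y, μ F.toFunctor x y ≍ μ G.toFunctor x y) :
    F = G := by
  obtain ⟨F, bF, _, _, _, _⟩ := F
  obtain ⟨G, bG, _, _, _, _⟩ := G
  obtain rfl : F = G := h
  obtain rfl : bF = bG := by
    apply Functor.Braided.toMonoidal_injective
    apply Functor.Monoidal.toLaxMonoidal_injective
    apply Functor.LaxMonoidal.ext
    · exact eq_of_heq hε
    · funext x y
      exact eq_of_heq (hμ x y)
  rfl

theorem HypergraphFunctor.io_comp_ff {C : Type u₁} [Category.{v₁} C] [MonoidalCategory C]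
    [SymmetricCategory C] [HypergraphCategory C] {D : Type u₂} [Category.{v₂} D]
    [MonoidalCategory D] [SymmetricCategory D] [HypergraphCategory D]
    (F : HypergraphFunctor C D) : F.io.comp F.ff = F :=
  HypergraphFunctor.ext_of_coherence rfl (heq_of_eq (Category.comp_id (ε F.toFunctor)))
    (fun x y => heq_of_eq (Category.comp_id (μ F.toFunctor x y)))

/-! ### Fully faithful morphisms are cartesian -/

namespace HypOF

variable {H E L : HypOF.{v, u}}

/-- A morphism into the domain of a faithful morphism `G` is determined by its values on generators,
which determine it on objects, and by its composite with `G`. -/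
theorem hom_ext_of_faithful (G : E ⟶ L) [G.functor.Faithful] {F F' : H ⟶ E}
    (h : genMap F = genMap F') (h' : F ≫ G = F' ≫ G) : F = F' := by
  refine hom_ext (HypergraphFunctor.functor_ext_of_faithful G.functor.toFunctor ?_
    (congrArg (fun K => K.functor.toFunctor) h'))
  intro x
  obtain ⟨x, rfl⟩ := H.objEquiv.surjective x
  rw [obj_objEquiv, obj_objEquiv, h]

section Factor

variable (K : H ⟶ L) (G : E ⟶ L) (f : H.gens → List E.gens)
  (w : ∀ a, genMap K a = (f a).flatMap (genMap G))

include w in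
theorem obj_eq_obj_flatMap (x : H.carrier) : K.functor.obj x =
    G.functor.obj (E.objEquiv ((H.objEquiv.symm x).flatMap f)) := by
  rw [fill_obj K f (genMap G) w, obj_objEquiv]

variable [G.functor.Full] [G.functor.Faithful]

/-- The functor underlying the factorization of `K` through `G` that is given by `f` on
generators. -/
noncomputable def factorFunctor : H.carrier ⥤ E.carrier where
  obj x := E.objEquiv ((H.objEquiv.symm x).flatMap f)
  map {x y} k := G.functor.preimage (eqToHom (obj_eq_obj_flatMap K G f w x).symm ≫
    K.functor.map k ≫ eqToHom (obj_eq_obj_flatMap K G f w y))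
  map_id x := G.functor.map_injective (by simp)
  map_comp k l := G.functor.map_injective (by simp)

/-- `K` is the composite of `factorFunctor` with `G`, up to equality of objects. -/
noncomputable def factorIso :
    K.functor.toFunctor ≅ factorFunctor K G f w ⋙ G.functor.toFunctor :=
  NatIso.ofComponents (fun x => eqToIso (obj_eq_obj_flatMap K G f w x))
    (fun {x y} k => by simp [factorFunctor])

theorem factorFunctor_unit : 𝟙_ E.carrier = (factorFunctor K G f w).obj (𝟙_ _) := by
  change _ = E.objEquiv ((H.objEquiv.symm (𝟙_ _)).flatMap f)
  rw [← H.objEquiv_nil, Equiv.symm_apply_apply, List.flatMap_nil, E.objEquiv_nil]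

theorem factorFunctor_tensor (x y : H.carrier) :
    (factorFunctor K G f w).obj x ⊗ (factorFunctor K G f w).obj y =
      (factorFunctor K G f w).obj (x ⊗ y) := by
  obtain ⟨x, rfl⟩ := H.objEquiv.surjective x
  obtain ⟨y, rfl⟩ := H.objEquiv.surjective y
  change E.objEquiv _ ⊗ E.objEquiv _ = E.objEquiv ((H.objEquiv.symm (_ ⊗ _)).flatMap f)
  rw [← H.objEquiv_append, Equiv.symm_apply_apply, Equiv.symm_apply_apply, Equiv.symm_apply_apply,
    List.flatMap_append, E.objEquiv_append]

/-- The factorization of a morphism `K` through a fully faithful morphism `G`, given a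
factorization `f` on generators. -/
noncomputable def factor : H ⟶ E where
  functor := HypergraphFunctor.fill G.functor (factorFunctor K G f w) K.functor
    (factorIso K G f w)
    (fun x => FrobeniusStructure.isTransport_eqToIso (obj_eq_obj_flatMap K G f w x))
  strict := {
    obj_unit := factorFunctor_unit K G f w
    obj_tensor := factorFunctor_tensor K G f w
    ε_eq := G.functor.map_injective (by
      refine (HypergraphFunctor.map_fill_ε _ _ _ (factorIso K G f w)).trans ?_
      refine Eq.trans ?_ (eqToHom_map G.functor.toFunctor _).symm
      -- `G` is strict, so that the inverses of its coherence maps are identities, too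
      have hη : η G.functor.toFunctor = eqToHom G.strict.obj_unit.symm := by
        rw [← cancel_epi (ε G.functor.toFunctor), Functor.Monoidal.ε_η, G.strict.ε_eq]
        simp
      rw [K.strict.ε_eq, hη]
      exact eqToHom_comp₃ _ _ (obj_eq_obj_flatMap K G f w (𝟙_ _)))
    μ_eq := fun x y => G.functor.map_injective (by
      refine (HypergraphFunctor.map_fill_μ _ _ _ (factorIso K G f w) x y).trans ?_
      refine Eq.trans ?_ (eqToHom_map G.functor.toFunctor _).symm
      have hδ (a b : E.carrier) : δ G.functor.toFunctor a b =
          eqToHom (G.strict.obj_tensor a b).symm := by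
        rw [← cancel_epi (μ G.functor.toFunctor a b), Functor.Monoidal.μ_δ, G.strict.μ_eq]
        simp
      rw [K.strict.μ_eq, hδ]
      exact eqToHom_comp_tensor _ (obj_eq_obj_flatMap K G f w x).symm
        (obj_eq_obj_flatMap K G f w y).symm _ (obj_eq_obj_flatMap K G f w (x ⊗ y))) }

theorem factor_comp : factor K G f w ≫ G = K := by
  refine hom_ext (CategoryTheory.Functor.ext
    (fun x => (obj_eq_obj_flatMap K G f w x).symm) ?_)
  intro x y k
  exact G.functor.map_preimage _

theorem genMap_factor : genMap (factor K G f w) = f := by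
  funext a
  change E.objEquiv.symm (E.objEquiv ((H.objEquiv.symm (H.objEquiv [a])).flatMap f)) = f a
  rw [Equiv.symm_apply_apply, Equiv.symm_apply_apply, List.flatMap_singleton]

end Factor

/-- A fully faithful strict hypergraph functor is cartesian: a factorization on generators
determines the factorization on objects, the objects being freely generated, and full
faithfulness determines it on morphisms. -/
theorem isStronglyCartesian_of_fullyFaithful (G : E ⟶ L) [G.functor.Full] [G.functor.Faithful] :
    Gens.IsStronglyCartesian (Gens.map G) G where
  universal_property' {H} f K hK := by
    have w (a : H.gens) : genMap K a = (f a).flatMap (genMap G) :=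
      congrFun (IsHomLift.eq_of_isHomLift Gens (f ≫ Gens.map G) K).symm a
    obtain ⟨M, hM, hMG⟩ : ∃ M : H ⟶ E, Gens.map M = f ∧ M ≫ G = K :=
      ⟨factor K G f w, genMap_factor K G f w, factor_comp K G f w⟩
    refine ⟨M, ⟨?_, hMG⟩, ?_⟩
    · rw [← hM]
      exact .map _
    · rintro F ⟨hF, hFG⟩
      refine hom_ext_of_faithful G ?_ (hFG.trans hMG.symm)
      exact (IsHomLift.eq_of_isHomLift Gens f F).symm.trans hM.symm

theorem genMap_lift {Λ : Type u} (g : Λ → List H.gens) : genMap (H.lift g) = g := by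
  funext a
  refine (H.objEquiv.symm_apply_apply _).trans ?_
  exact List.flatMap_singleton g a

/-- The chosen lifts are fully faithful, hence cartesian. -/
theorem isStronglyCartesian_lift {Λ : Type u} (g : Λ → List H.gens) :
    Gens.IsStronglyCartesian (R := KleisliCat.mk List Λ) (S := Gens.obj H) g (H.lift g) := by
  have e : Gens.map (H.lift g) = g := genMap_lift (H := H) g
  have h := isStronglyCartesian_of_fullyFaithful (H.lift g)
  rwa [e] at h

instance (F : H ⟶ L) : (ffPart F).functor.Full :=
  inferInstanceAs (Induced.toBase F.functor.factorData).Full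

instance (F : H ⟶ L) : (ffPart F).functor.Faithful :=
  inferInstanceAs (Induced.toBase F.functor.factorData).Faithful

theorem ioPart_comp_ffPart (F : H ⟶ L) : ioPart F ≫ ffPart F = F :=
  Hom.ext F.functor.io_comp_ff

theorem genMap_ioPart (F : H ⟶ L) : Gens.map (ioPart F) = 𝟙 (Gens.obj H) := by
  funext a
  exact H.objEquiv.symm_apply_apply [a]

end HypOF

/-! ### Equality of hypergraph categories with the same objects -/

/-- Two category structures with the same hom-types are equal if the identity map on morphisms is
a functor between them. -/
theorem category_eq_of_functor {X : Type u} (c₁ c₂ : Category.{v} X)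
    (hhom : ∀ x y, c₁.Hom x y = c₂.Hom x y) (F : @Functor X c₁ X c₂)
    (hobj : ∀ x, @Functor.obj X c₁ X c₂ F x = x)
    (hmap : ∀ x y (k : c₁.Hom x y), @CategoryTheory.Functor.map X c₁ X c₂ F x y k ≍ k) :
    c₁ = c₂ ∧ F ≍ @Functor.id X c₁ := by
  obtain @⟨@⟨⟨Hom⟩, id₁, comp₁⟩, _, _, _⟩ := c₁
  obtain @⟨@⟨⟨Hom'⟩, id₂, comp₂⟩, _, _, _⟩ := c₂
  obtain rfl : Hom = Hom' := funext fun x => funext fun y => hhom x y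
  obtain ⟨obj, map, map_id, map_comp⟩ := F
  obtain rfl : obj = fun x => x := funext hobj
  obtain rfl : @map = fun _ _ k => k := by
    funext x y k
    exact eq_of_heq (hmap x y k)
  obtain rfl : id₁ = id₂ := funext map_id
  obtain rfl : @comp₁ = @comp₂ := by
    funext x y z k l
    exact map_comp k l
  exact ⟨rfl, HEq.rfl⟩

/-- Two monoidal structures with the same product of objects and the same unit are equal if the
identity functor is strict monoidal from the one to the other. -/
theorem monoidalCategory_eq_of_strict {X : Type u} [Category.{v} X] (m₁ m₂ : MonoidalCategory X)
    (L : @Functor.LaxMonoidal X _ m₁ X _ m₂ (𝟭 X))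
    (ht : ∀ x y : X, m₂.tensorObj x y = m₁.tensorObj x y) (hu : m₂.tensorUnit = m₁.tensorUnit)
    (hε : L.ε = eqToHom hu) (hμ : ∀ x y, L.μ x y = eqToHom (ht x y)) : m₁ = m₂ := by
  obtain ⟨ε, μ, nl, nr, as, lu, ru⟩ := L
  obtain @⟨@⟨t₁, wl₁, wr₁, th₁, u₁, a₁, l₁, r₁⟩, hd₁, _⟩ := m₁
  obtain @⟨@⟨t₂, wl₂, wr₂, th₂, u₂, a₂, l₂, r₂⟩, hd₂, _, _, hwl, hwr, _⟩ := m₂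
  obtain rfl : t₂ = t₁ := funext fun x => funext fun y => ht x y
  obtain rfl : u₂ = u₁ := hu
  obtain rfl : ε = 𝟙 u₂ := hε
  obtain rfl : μ = fun x y => 𝟙 (t₂ x y) := funext fun x => funext fun y => hμ x y
  obtain rfl : wl₁ = wl₂ := by
    funext x y z f
    exact (Category.id_comp _).symm.trans ((nr x f).symm.trans (Category.comp_id _))
  obtain rfl : @wr₁ = @wr₂ := by
    funext x y f z
    exact (Category.id_comp _).symm.trans ((nl f z).symm.trans (Category.comp_id _))
  obtain rfl : @th₁ = @th₂ := by
    funext x y x' y' f g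
    exact (hd₁ f g).trans (hd₂ f g).symm
  obtain rfl : a₁ = a₂ := by
    funext x y z
    refine Iso.ext ?_
    have h : wr₁ (𝟙 (t₂ x y)) z ≫ 𝟙 _ ≫ (a₁ x y z).hom =
      (a₂ x y z).hom ≫ wl₁ x (𝟙 (t₂ y z)) ≫ 𝟙 _ := as x y z
    rw [show wr₁ (𝟙 (t₂ x y)) z = 𝟙 _ from hwr _ _, show wl₁ x (𝟙 (t₂ y z)) = 𝟙 _ from hwl _ _]
      at h
    simpa using h
  obtain rfl : l₁ = l₂ := by
    funext x
    refine Iso.ext ?_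
    have h : (l₂ x).hom = wr₁ (𝟙 u₂) x ≫ 𝟙 _ ≫ (l₁ x).hom := lu x
    rw [show wr₁ (𝟙 u₂) x = 𝟙 _ from hwr _ _] at h
    simpa using h.symm
  obtain rfl : r₁ = r₂ := by
    funext x
    refine Iso.ext ?_
    have h : (r₂ x).hom = wl₁ x (𝟙 u₂) ≫ 𝟙 _ ≫ (r₁ x).hom := ru x
    rw [show wl₁ x (𝟙 u₂) = 𝟙 _ from hwl _ _] at h
    simpa using h.symm
  rfl

theorem symmetricCategory_ext {C : Type u} [Category.{v} C] [MonoidalCategory C]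
    {s₁ s₂ : SymmetricCategory C}
    (h : ∀ x y, (s₁.braiding x y).hom = (s₂.braiding x y).hom) : s₁ = s₂ := by
  obtain @⟨@⟨b₁, _⟩, _⟩ := s₁
  obtain @⟨@⟨b₂, _⟩, _⟩ := s₂
  obtain rfl : b₁ = b₂ := funext fun x => funext fun y => Iso.ext (h x y)
  rfl

theorem FrobeniusStructure.ext {C : Type u} [Category.{v} C] [MonoidalCategory C]
    [BraidedCategory C] {x : C} {S T : FrobeniusStructure x} (hmul : S.mul = T.mul)
    (hunit : S.unit = T.unit) (hcomul : S.comul = T.comul) (hcounit : S.counit = T.counit) :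
    S = T := by
  cases S
  cases T
  cases hmul
  cases hunit
  cases hcomul
  cases hcounit
  rfl

theorem hypergraphCategory_ext {C : Type u} [Category.{v} C] [MonoidalCategory C]
    [SymmetricCategory C] {h₁ h₂ : HypergraphCategory C} (h : ∀ x, h₁.frob x = h₂.frob x) :
    h₁ = h₂ := by
  cases h₁
  cases h₂
  obtain rfl := funext h
  rfl

/-- Two hypergraph structures on a category are equal if the identity functor is a strict
hypergraph functor from the one to the other. -/
theorem hypergraphCategory_eq_of_strict {X : Type u} [Category.{v} X] {m₁ m₂ : MonoidalCategory X}
    {s₁ : @SymmetricCategory X _ m₁} {s₂ : @SymmetricCategory X _ m₂}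
    {h₁ : @HypergraphCategory X _ m₁ s₁} {h₂ : @HypergraphCategory X _ m₂ s₂}
    (F : @HypergraphFunctor X _ m₁ s₁ h₁ X _ m₂ s₂ h₂)
    (hF : @HypergraphFunctor.IsStrict X _ m₁ s₁ h₁ X _ m₂ s₂ h₂ F)
    (hid : @HypergraphFunctor.toFunctor X _ m₁ s₁ h₁ X _ m₂ s₂ h₂ F = 𝟭 X) :
    m₁ = m₂ ∧ s₁ ≍ s₂ ∧ h₁ ≍ h₂ := by
  obtain ⟨F, b, hmul, hunit, hcomul, hcounit⟩ := F
  obtain ⟨hu, ht, hε, hμ⟩ := hF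
  obtain rfl : F = 𝟭 X := hid
  let M : @Functor.Monoidal X _ m₁ X _ m₂ (𝟭 X) := @Functor.Braided.toMonoidal _ _ _ _ _ _ _ _ _ b
  obtain rfl : m₁ = m₂ := monoidalCategory_eq_of_strict m₁ m₂
    (@Functor.Monoidal.toLaxMonoidal _ _ _ _ _ _ _ M) ht hu hε hμ
  replace hμ (x y : X) : M.μ x y = 𝟙 (x ⊗ y) := hμ x y
  replace hε : M.ε = 𝟙 (𝟙_ X) := hε
  have hδ (x y : X) : M.δ x y = 𝟙 (x ⊗ y) := by
    have e : M.μ x y ≫ M.δ x y = 𝟙 (x ⊗ y) := M.μ_δ x y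
    rw [hμ] at e
    exact (Category.id_comp _).symm.trans e
  have hη : M.η = 𝟙 (𝟙_ X) := by
    have e : M.ε ≫ M.η = 𝟙 (𝟙_ X) := M.ε_η
    rw [hε] at e
    exact (Category.id_comp _).symm.trans e
  obtain rfl : s₁ = s₂ := by
    refine symmetricCategory_ext fun x y => ?_
    have e : M.μ x y ≫ (s₁.braiding x y).hom = (s₂.braiding x y).hom ≫ M.μ y x :=
      @Functor.LaxBraided.braided X _ m₁ s₁.toBraidedCategory X _ m₁ s₂.toBraidedCategory (𝟭 X)
        (@Functor.Braided.toLaxBraided X _ m₁ s₁.toBraidedCategory X _ m₁ s₂.toBraidedCategory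
          (𝟭 X) b) x y
    rw [hμ, hμ] at e
    exact (Category.id_comp _).symm.trans (e.trans (Category.comp_id _))
  obtain rfl : h₁ = h₂ := by
    refine hypergraphCategory_ext fun x => (FrobeniusStructure.ext ?_ ?_ ?_ ?_).symm
    · have e : (h₂.frob x).mul = M.μ x x ≫ (h₁.frob x).mul := hmul x
      rw [e, hμ]
      exact Category.id_comp _
    · have e : (h₂.frob x).unit = M.ε ≫ (h₁.frob x).unit := hunit x
      rw [e, hε]
      exact Category.id_comp _
    · have e : (h₂.frob x).comul = (h₁.frob x).comul ≫ M.δ x x := hcomul x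
      rw [e, hδ]
      exact Category.comp_id _
    · have e : (h₂.frob x).counit = (h₁.frob x).counit ≫ M.η := hcounit x
      rw [e, hη]
      exact Category.comp_id _
  exact ⟨rfl, HEq.rfl, HEq.rfl⟩

/-- Two hypergraph categories with object monoid `List Λ` and with the same hom-types are equal if
the identity map on objects and morphisms is a strict hypergraph functor between them, and that
functor is then the identity up to this equality. -/
theorem HypOn.eq_of_hom {Λ : Type u} {A B : HypOn.{v} Λ} (F : A.toHypOF ⟶ B.toHypOF)
    (hhom : ∀ x y : List Λ, A.category.Hom x y = B.category.Hom x y)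
    (hobj : ∀ x : List Λ, F.functor.obj x = x)
    (hmap : ∀ (x y : List Λ) (k : A.category.Hom x y),
      @CategoryTheory.Functor.map _ A.category _ B.category F.functor.toFunctor x y k ≍ k) :
    ∃ h : A = B, F = eqToHom (congrArg HypOn.toHypOF h) := by
  obtain @⟨c₁, m₁, s₁, h₁, i₁, u₁, t₁⟩ := A
  obtain @⟨c₂, m₂, s₂, h₂, i₂, u₂, t₂⟩ := B
  obtain ⟨rfl, hF⟩ := category_eq_of_functor c₁ c₂ hhom F.functor.toFunctor hobj hmap
  obtain ⟨rfl, hs, hh⟩ := hypergraphCategory_eq_of_strict F.functor F.strict (eq_of_heq hF)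
  obtain rfl := eq_of_heq hs
  obtain rfl := eq_of_heq hh
  exact ⟨rfl, HypOF.hom_ext (eq_of_heq hF)⟩

/-! ### The chosen lifts -/

namespace HypOF

/-- The domain of the chosen lift of `g` is determined by its hom-types: a strict hypergraph functor
to `K` from a category with object monoid `List Λ` is the lift of `g` if it induces `g` on
generators and is the identity on morphisms. -/
theorem eq_pull {Λ : Type u} {A : HypOn.{v} Λ} {K : HypOF.{v, u}} (F : A.toHypOF ⟶ K)
    (g : Λ → List K.gens) (hg : genMap F = g)
    (hhom : ∀ x y : List Λ, A.category.Hom x y =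
      (K.objEquiv (x.flatMap g) ⟶ K.objEquiv (y.flatMap g)))
    (hmap : ∀ (x y : List Λ) (k : A.category.Hom x y),
      @CategoryTheory.Functor.map _ A.category _ _ F.functor.toFunctor x y k ≍ k) :
    ∃ h : A = K.pull g, F = eqToHom (congrArg HypOn.toHypOF h) ≫ K.lift g := by
  subst hg
  have w (a : A.toHypOF.gens) : genMap F a = (pure a : List Λ).flatMap (genMap F) :=
    (List.flatMap_singleton (genMap F) a).symm
  -- the comparison functor to `K.pull g` is the identity on objects, and on morphisms up to the
  -- equality of `F.functor.obj x` with the image of the word `x.flatMap g`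
  obtain ⟨h, e⟩ := HypOn.eq_of_hom (fill F pure (genMap F) w) hhom
    (fun x => (List.flatMap_pure_eq_map _ _).trans (List.map_id x)) (fun x y k => by
      refine HEq.trans ?_ (hmap x y k)
      exact (eqToHom_comp_heq _ _).trans (comp_eqToHom_heq _ _))
  exact ⟨h, (fill_lift F pure (genMap F) w).symm.trans
    (congrArg (fun M => M ≫ K.lift (genMap F)) e)⟩

/-- The lift of an identity is an identity, if the object monoid is `List Λ`. -/
theorem eq_pull_pure {Λ : Type u} (A : HypOn.{v} Λ) :
    ∃ h : A.toHypOF.pull (fun a : Λ => [a]) = A,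
      A.toHypOF.lift (fun a : Λ => [a]) = eqToHom (congrArg HypOn.toHypOF h) := by
  obtain ⟨h, e⟩ := eq_pull (𝟙 A.toHypOF) (fun a : Λ => [a]) rfl
    (fun x y => by
      change _ = A.category.Hom (x.flatMap fun a => [a]) (y.flatMap fun a => [a])
      simp) (fun _ _ _ => HEq.rfl)
  exact ⟨h.symm, by rw [← cancel_epi (eqToHom (congrArg HypOn.toHypOF h)), ← e]; simp⟩

/-- The lift of a composite in the Kleisli category is the composite of the lifts. -/
theorem pull_pull {Λ₁ Λ₂ : Type u} (K : HypOF.{v, u}) (g : Λ₂ → List K.gens) (f : Λ₁ → List Λ₂) :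
    ∃ h : K.pull (fun a => (f a).flatMap g) = (K.pull g).toHypOF.pull f,
      K.lift (fun a => (f a).flatMap g) =
        eqToHom (congrArg HypOn.toHypOF h) ≫ (K.pull g).toHypOF.lift f ≫ K.lift g := by
  obtain ⟨h, e⟩ := eq_pull ((K.pull g).toHypOF.lift f ≫ K.lift g) (fun a => (f a).flatMap g)
    (by
      funext a
      rw [genMap_comp, genMap_lift]
      exact congrArg (List.flatMap g) (congrFun (genMap_lift (H := (K.pull g).toHypOF) f) a))
    (fun x y => by
      change (K.objEquiv ((x.flatMap f).flatMap g) ⟶ K.objEquiv ((y.flatMap f).flatMap g)) = _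
      rw [List.flatMap_assoc, List.flatMap_assoc]) (fun _ _ _ => HEq.rfl)
  exact ⟨h.symm, by rw [e]; simp⟩

/-- The middle category of the factorization of a morphism, if the object monoid of the domain is
`List Λ`. -/
def midOn {Λ : Type u} {A : HypOn.{v} Λ} {K : HypOF.{v, u}} (F : A.toHypOF ⟶ K) : HypOn.{v} Λ where
  category := (mid F).category
  monoidal := (mid F).monoidal
  symmetric := (mid F).symmetric
  hypergraph := (mid F).hypergraph
  strict := (mid F).strict
  unit_eq := A.unit_eq
  tensor_eq := A.tensor_eq

/-- If the object monoid of the domain is `List Λ`, then the fully faithful part of `F` is the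
chosen lift: the two middle categories have the same hom-types, since `F` sends the word `x` to the
object that corresponds to `x.flatMap (genMap F)`. -/
theorem mid_eq_pull {Λ : Type u} {A : HypOn.{v} Λ} {K : HypOF.{v, u}} (F : A.toHypOF ⟶ K) :
    ∃ h : mid F = (K.pull (genMap F)).toHypOF, ffPart F = eqToHom h ≫ K.lift (genMap F) := by
  obtain ⟨h, e⟩ := eq_pull (A := midOn F) (ffPart F) (genMap F) rfl
    (fun x y => congrArg₂ (fun a b : K.carrier => (a ⟶ b)) (obj_objEquiv F x) (obj_objEquiv F y))
    (fun _ _ _ => HEq.rfl)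
  exact ⟨_, e⟩

end HypOF

/-! ### The cleavages -/

theorem gensLifts_isCleavage : gensLifts.{v, u}.IsCleavage :=
  fun _ _ g => HypOF.isStronglyCartesian_lift g

/-- A functor with a cleavage is a fibration. -/
theorem LiftChoice.IsCleavage.isFibered {E : Type u₁} [Category.{v₁} E] {B : Type u₂}
    [Category.{v₂} B] {p : E ⥤ B} {c : LiftChoice p} (hc : c.IsCleavage) : p.IsFibered :=
  Functor.IsFibered.of_exists_isStronglyCartesian fun _ _ g => ⟨c.dom g, c.lift g, hc g⟩

theorem gensLifts_compClosed : gensLifts.{v, u}.CompClosed := by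
  intro K Λ Λ' g f
  have hg : Gens.map (K.lift g) = g := HypOF.genMap_lift (H := K) g
  have hc : f ≫ Gens.map (gensLifts.lift g) = fun a => (f a).flatMap g :=
    congrArg (fun g' => f ≫ g') hg
  rw [hc]
  obtain ⟨h, e⟩ := K.pull_pull g f
  exact ⟨congrArg HypOn.toHypOF h, e⟩

theorem isHomLift_comp_iff {E' : Type u₁} [Category.{v₁} E'] {E : Type u₂} [Category.{v₂} E]
    {B : Type u₃} [Category.{v₃} B] (q : E' ⥤ E) (p : E ⥤ B) {X Y : E'} (φ : X ⟶ Y) {R S : B}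
    (f : R ⟶ S) : (q ⋙ p).IsHomLift f φ ↔ p.IsHomLift f (q.map φ) :=
  ⟨fun _ => IsHomLift.of_fac p f _ (IsHomLift.domain_eq (q ⋙ p) f φ)
    (IsHomLift.codomain_eq (q ⋙ p) f φ) (IsHomLift.fac (q ⋙ p) f φ),
  fun _ => IsHomLift.of_fac (q ⋙ p) f _ (IsHomLift.domain_eq p f (q.map φ))
    (IsHomLift.codomain_eq p f (q.map φ)) (IsHomLift.fac p f (q.map φ))⟩

/-- Fully faithful functors reflect cartesian morphisms. -/
theorem isStronglyCartesian_comp {E' : Type u₁} [Category.{v₁} E'] {E : Type u₂} [Category.{v₂} E]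
    {B : Type u₃} [Category.{v₃} B] (q : E' ⥤ E) [q.Full] [q.Faithful] (p : E ⥤ B) {X Y : E'}
    {φ : X ⟶ Y} {R S : B} {f : R ⟶ S} (h : p.IsStronglyCartesian f (q.map φ)) :
    (q ⋙ p).IsStronglyCartesian f φ where
  toIsHomLift := (isHomLift_comp_iff q p φ f).2 h.toIsHomLift
  universal_property' {Z} g ψ hψ := by
    have := (isHomLift_comp_iff q p ψ (g ≫ f)).1 hψ
    obtain ⟨χ, ⟨hχ, hχψ⟩, huniq⟩ := h.universal_property' g (q.map ψ)
    obtain ⟨χ, rfl⟩ := q.map_surjective χ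
    refine ⟨χ, ⟨(isHomLift_comp_iff q p χ g).2 hχ, q.map_injective (by rw [q.map_comp, hχψ])⟩, ?_⟩
    rintro χ' ⟨hχ', e⟩
    exact q.map_injective (huniq _ ⟨(isHomLift_comp_iff q p χ' g).1 hχ', by rw [← e, q.map_comp]⟩)

theorem eqToHom_fullSubcategory_hom {E : Type u₁} [Category.{v₁} E] {P : ObjectProperty E}
    {X Y : P.FullSubcategory} (h : X = Y) :
    (eqToHom h).hom = eqToHom (congrArg ObjectProperty.FullSubcategory.obj h) := by
  subst h
  rfl

theorem gensLiftsListed_isCleavage : gensLiftsListed.{v, u}.IsCleavage := fun K _ g =>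
  isStronglyCartesian_comp isListed.ι Gens (HypOF.isStronglyCartesian_lift (H := K.obj) g)

theorem gensLiftsListed_compClosed : gensLiftsListed.{v, u}.CompClosed := by
  intro K Λ Λ' g f
  obtain ⟨h, e⟩ := gensLifts_compClosed (e := K.obj) g f
  refine ⟨ObjectProperty.FullSubcategory.ext h, ObjectProperty.hom_ext _ ?_⟩
  refine Eq.trans e ?_
  rw [ObjectProperty.FullSubcategory.comp_hom, eqToHom_fullSubcategory_hom]
  rfl

theorem gensLiftsListed_idClosed : gensLiftsListed.{v, u}.IdClosed := by
  rintro ⟨_, Λ, A, rfl⟩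
  obtain ⟨h, e⟩ := HypOF.eq_pull_pure A
  refine ⟨ObjectProperty.FullSubcategory.ext (congrArg HypOn.toHypOF h),
    ObjectProperty.hom_ext _ ?_⟩
  rw [eqToHom_fullSubcategory_hom]
  exact e

/-- The lift of an identity is cartesian over an isomorphism. Hence every objectwise-free hypergraph
category is isomorphic to one whose object monoid is a free monoid `List Λ` on the nose. -/
instance HypOF.isIso_lift_pure (H : HypOF.{v, u}) :
    IsIso (H.lift (fun a : H.gens => [a])) := by
  have : Gens.IsStronglyCartesian (𝟙 (Gens.obj H)) (H.lift (fun a : H.gens => [a])) :=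
    HypOF.isStronglyCartesian_lift (H := H) (fun a => [a])
  exact Functor.IsStronglyCartesian.isIso_of_base_isIso Gens (𝟙 (Gens.obj H)) _

instance isListed_ι_isEquivalence : isListed.{v, u}.ι.IsEquivalence where
  essSurj.mem_essImage H := ⟨⟨(H.pull fun a => [a]).toHypOF, _, _, rfl⟩,
    ⟨asIso (H.lift fun a => [a])⟩⟩

/-! ### The Grothendieck construction -/

theorem HypOn.eqToHom_hom {Λ : Type u} {A B : HypOn.{v} Λ} (h : A = B) :
    HypOn.Hom.hom (eqToHom h) = eqToHom (congrArg HypOn.toHypOF h) := by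
  subst h
  rfl

theorem HypOn.eqToHom_comp_hom {Λ : Type u} {A A' B B' : HypOn.{v} Λ} (hA : A' = A) (hB : B' = B)
    (F : A ⟶ B) : HypOn.Hom.hom (eqToHom hA ≫ F ≫ eqToHom hB.symm) =
      eqToHom (congrArg HypOn.toHypOF hA) ≫ F.hom ≫ eqToHom (congrArg HypOn.toHypOF hB).symm := by
  subst hA hB
  rfl

/-- The bookkeeping of equalities in the functoriality of `pullFunctor`: `F'` and `F` fit into
commutative squares with the same right side `G`, and the horizontal sides agree up to equalities of
objects. -/
theorem comp_eq_eqToHom_comp {C : Type u} [Category.{v} C] {a a' b b' c d : C} (hA : a' = a)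
    (hB : b' = b) {F' : a' ⟶ b'} {F : a ⟶ b} {l' : a' ⟶ c} {l : a ⟶ c} {m' : b' ⟶ d} {m : b ⟶ d}
    {G : c ⟶ d} (hl : l' = eqToHom hA ≫ l) (hm : m' = eqToHom hB ≫ m) (h' : F' ≫ m' = l' ≫ G)
    (h : F ≫ m = l ≫ G) : F' ≫ m' = (eqToHom hA ≫ F ≫ eqToHom hB.symm) ≫ m' := by
  subst hA hB
  simp_all

theorem HypOn.pullFunctorial : HypOn.PullFunctorial.{v, u} where
  map_id Λ := by
    choose h e using fun A : HypOn.{v} Λ => HypOF.eq_pull_pure A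
    refine CategoryTheory.Functor.ext h fun A B F =>
      HypOn.hom_ext_of_lift (fun a : Λ => [a]) ?_
    refine Eq.trans ?_ (congrArg (fun M => M ≫ HypOF.lift _ _)
      (HypOn.eqToHom_comp_hom (h A) (h B) F).symm)
    exact comp_eq_eqToHom_comp _ _ ((e A).trans (Category.comp_id _).symm)
      ((e B).trans (Category.comp_id _).symm) (HypOn.pullMap_lift (fun a : Λ => [a]) F)
      ((Category.comp_id _).trans (Category.id_comp _).symm)
  map_comp {Λ₁ Λ₂ Λ₃} f g := by
    choose h e using fun A : HypOn.{v} Λ₃ => HypOF.pull_pull A.toHypOF g f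
    refine CategoryTheory.Functor.ext h fun A B F =>
      HypOn.hom_ext_of_lift (fun a => (f a).flatMap g) ?_
    refine Eq.trans ?_ (congrArg (fun M => M ≫ HypOF.lift _ _)
      (HypOn.eqToHom_comp_hom (h A) (h B) (HypOn.pullMap f (HypOn.pullMap g F))).symm)
    refine comp_eq_eqToHom_comp _ _ (e A) (e B)
      (HypOn.pullMap_lift (fun a => (f a).flatMap g) F) ?_
    rw [← Category.assoc, HypOn.pullMap_lift, Category.assoc, HypOn.pullMap_lift, Category.assoc]

namespace TotalOF

variable {h : HypOn.PullFunctorial.{v, u}}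

theorem genMap_toHom {X Y : TotalOF.{v, u} h} (k : X ⟶ Y) : HypOF.genMap (toHom k) = k.base := by
  funext a
  refine (HypOF.genMap_comp _ _ a).trans ?_
  refine (congrArg₂ List.flatMap (HypOF.genMap_lift (H := toHypOF Y) k.base)
    (congrFun (HypOn.genMap_hom (Λ := X.base) k.fiber) a)).trans ?_
  exact List.flatMap_singleton k.base a

theorem comp_eqToHom_comp_of_square {C : Type u} [Category.{v} C] {a b b' b'' c c' d : C}
    (x : a ⟶ b) {p : b ⟶ b'} (e : b' = b'') (e' : b'' = b') {m : b' ⟶ c} (y : c ⟶ d) {l : b ⟶ c'}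
    {s : c' ⟶ c} (h : p ≫ m = l ≫ s) :
    (x ≫ p ≫ eqToHom e) ≫ eqToHom e' ≫ m ≫ y = (x ≫ l) ≫ s ≫ y := by
  subst e
  simp [reassoc_of% h]

/-- The coherence isomorphisms of the pseudofunctor that comes from a functor to `Cat` are of the
form `eqToHom e`, so that their components are identities up to equality of objects. -/
theorem cat_eqToHom_app {C D : Cat.{v₁, u₁}} {F G : C ⟶ D} (e : F = G) (x : C) :
    (eqToHom e).toNatTrans.app x = eqToHom (by rw [e]) := by
  subst e
  rfl

/-- The generators of `(Λ, A)`. -/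
def gens (X : TotalOF.{v, u} h) : Type u := X.base

/-- The second component of an object, as a hypergraph category objectwise-free on the first. -/
def listed (X : TotalOF.{v, u} h) : HypOn.{v, u} X.gens := X.fiber

/-- The first component of a morphism, as a map from generators to words. -/
def wordMap {X Y : TotalOF.{v, u} h} (k : X ⟶ Y) : X.gens → List Y.gens := k.base

/-- The second component of a morphism, as an identity-on-objects functor. -/
def listedHom {X Y : TotalOF.{v, u} h} (k : X ⟶ Y) :
    X.listed ⟶ (HypOn.pullFunctor (wordMap k)).obj Y.listed := k.fiber

theorem listedHom_id (X : TotalOF.{v, u} h) :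
    ∃ e : X.listed = (HypOn.pullFunctor fun a => [a]).obj X.listed,
      listedHom (𝟙 X) = eqToHom e :=
  ⟨_, cat_eqToHom_app (h.fiberHom_id X.gens).symm _⟩

theorem listedHom_comp {X Y Z : TotalOF.{v, u} h} (k : X ⟶ Y) (l : Y ⟶ Z) :
    ∃ e : (HypOn.pullFunctor (wordMap k)).obj ((HypOn.pullFunctor (wordMap l)).obj Z.listed) =
        (HypOn.pullFunctor fun a => (wordMap k a).flatMap (wordMap l)).obj Z.listed,
      listedHom (k ≫ l) =
        listedHom k ≫ (HypOn.pullFunctor (wordMap k)).map (listedHom l) ≫ eqToHom e :=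
  ⟨_, congrArg (fun t => listedHom k ≫ (HypOn.pullFunctor (wordMap k)).map (listedHom l) ≫ t)
    (cat_eqToHom_app (h.fiberHom_comp (wordMap k) (wordMap l)).symm _)⟩

theorem toHom_id (X : TotalOF.{v, u} h) : toHom (𝟙 X) = 𝟙 (toHypOF X) := by
  obtain ⟨e, he⟩ := listedHom_id X
  obtain ⟨e', he'⟩ := HypOF.eq_pull_pure X.listed
  have h₁ : (listedHom (𝟙 X)).hom = eqToHom (congrArg HypOn.toHypOF e) :=
    (congrArg HypOn.Hom.hom he).trans (HypOn.eqToHom_hom e)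
  change (listedHom (𝟙 X)).hom ≫ X.listed.toHypOF.lift (fun a => [a]) = 𝟙 X.listed.toHypOF
  exact (congrArg₂ (fun s t => s ≫ t) h₁ he').trans (eqToHom_trans _ _)

/-- By definition, the composite of `(f, k)` and `(g, l)` is given by `k`, by the restriction of `l`
along `f`, and by the lift of the composite of `f` and `g`. The latter lift is the composite of the
lifts of `f` and of `g`, and the restriction of `l` commutes with the lifts of `f`. -/
theorem toHom_comp {X Y Z : TotalOF.{v, u} h} (k : X ⟶ Y) (l : Y ⟶ Z) :
    toHom (k ≫ l) = toHom k ≫ toHom l := by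
  obtain ⟨e, he⟩ := listedHom_comp k l
  obtain ⟨e', he'⟩ := HypOF.pull_pull Z.listed.toHypOF (wordMap l) (wordMap k)
  have h₁ : (listedHom (k ≫ l)).hom = (listedHom k).hom ≫
      (HypOn.pullMap (wordMap k) (listedHom l)).hom ≫ eqToHom (congrArg HypOn.toHypOF e) := by
    refine (congrArg HypOn.Hom.hom he).trans ?_
    exact congrArg (fun t => (listedHom k).hom ≫ (HypOn.pullMap (wordMap k) (listedHom l)).hom ≫ t)
      (HypOn.eqToHom_hom e)
  have h₂ := HypOn.pullMap_lift (wordMap k) (listedHom l)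
  change (listedHom (k ≫ l)).hom ≫ Z.listed.toHypOF.lift
    (fun a => (wordMap k a).flatMap (wordMap l)) =
    ((listedHom k).hom ≫ Y.listed.toHypOF.lift (wordMap k)) ≫ (listedHom l).hom ≫
      Z.listed.toHypOF.lift (wordMap l)
  refine (congrArg₂ (fun s t => s ≫ t) h₁ he').trans ?_
  exact comp_eqToHom_comp_of_square _ _ _ _ h₂

/-- The functor from the Grothendieck construction to the category of objectwise-free hypergraph
categories. -/
noncomputable def toHypOFFunctor (h : HypOn.PullFunctorial.{v, u}) : TotalOF h ⥤ HypOF.{v, u} where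
  obj := toHypOF
  map := toHom
  map_id := toHom_id
  map_comp := toHom_comp

instance : (toHypOFFunctor h).Faithful where
  map_injective {X Y k l} e := by
    have hb : k.base = l.base :=
      (genMap_toHom k).symm.trans ((congrArg HypOF.genMap e).trans (genMap_toHom l))
    obtain ⟨b, k⟩ := k
    obtain ⟨b', l⟩ := l
    obtain rfl : b = b' := hb
    obtain rfl : k = l := HypOn.hom_ext_of_lift (Λ₁ := X.base) (Λ₂ := Y.base) b e
    rfl

instance : (toHypOFFunctor h).Full where
  map_surjective {X Y} F :=
    have w (a : X.base) : HypOF.genMap F a = (pure a : List X.base).flatMap (HypOF.genMap F) :=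
      (List.flatMap_singleton (HypOF.genMap F) a).symm
    ⟨{ base := HypOF.genMap F
       fiber := {
        hom := HypOF.fill (L := toHypOF Y) F pure (HypOF.genMap F) w
        obj_eq := fun x => (List.flatMap_pure_eq_map _ _).trans (List.map_id x) } },
      HypOF.fill_lift (L := toHypOF Y) F pure (HypOF.genMap F) w⟩

instance : (toHypOFFunctor h).EssSurj where
  mem_essImage H := ⟨⟨H.gens, H.pull fun a : H.gens => [a]⟩,
    ⟨@asIso HypOF _ _ _ (H.lift fun a : H.gens => [a]) (HypOF.isIso_lift_pure H)⟩⟩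

instance : (toHypOFFunctor h).IsEquivalence where

end TotalOF

end Hypergraph

open Hypergraph in
theorem mainTheorem7 :
    -- every hypergraph functor factors as identity-on-objects followed by fully faithful
    (∀ (C : Type u₁) [Category.{v₁} C] [MonoidalCategory C] [SymmetricCategory C]
      [HypergraphCategory C] (D : Type u₂) [Category.{v₂} D] [MonoidalCategory D]
      [SymmetricCategory D] [HypergraphCategory D] (F : HypergraphFunctor C D),
      F.io.comp F.ff = F ∧ (∀ x : C, F.io.obj x = x) ∧ F.ff.Full ∧ F.ff.Faithful) ∧
    -- `Gens` is a fibration, with a cleavage that is closed under composition on the nose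
    (Gens.{v, u}.IsFibered ∧ gensLifts.{v, u}.IsCleavage ∧ gensLifts.{v, u}.CompClosed) ∧
    -- the fully faithful part of a morphism `F` is a cartesian lift of `Gens.map F`
    (∀ (H K : HypOF.{v, u}) (F : H ⟶ K),
      HypOF.ioPart F ≫ HypOF.ffPart F = F ∧
      Gens.IsHomLift (𝟙 (Gens.obj H)) (HypOF.ioPart F) ∧
      Gens.IsStronglyCartesian (Gens.map F) (HypOF.ffPart F)) ∧
    -- and it is the chosen lift if the object monoid of the domain is `List Λ`
    (∀ (Λ : Type u) (A : HypOn.{v} Λ) (K : HypOF.{v, u}) (F : A.toHypOF ⟶ K),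
      ∃ h : HypOF.mid F = gensLifts.dom (Gens.map F),
        HypOF.ffPart F = eqToHom h ≫ gensLifts.lift (Gens.map F)) ∧
    -- on the equivalent full subcategory of categories with object monoid `List Λ`, the same
    -- lifts are closed under identities, too
    (isListed.{v, u}.ι.IsEquivalence ∧ (isListed.{v, u}.ι ⋙ Gens).IsFibered ∧
      gensLiftsListed.{v, u}.IsCleavage ∧ gensLiftsListed.{v, u}.CompClosed ∧
      gensLiftsListed.{v, u}.IdClosed) ∧
    -- `Λ ↦ HypOn Λ` is a functor, and its Grothendieck construction is equivalent to `HypOF`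
    -- over the base
    ∃ (h : HypOn.PullFunctorial.{v, u}) (T : TotalOF h ≌ HypOF.{v, u})
      (hT : ∀ X : TotalOF h, T.functor.obj X = TotalOF.toHypOF X),
      (∀ {X Y : TotalOF h} (k : X ⟶ Y),
        T.functor.map k = eqToHom (hT X) ≫ TotalOF.toHom k ≫ eqToHom (hT Y).symm) ∧
      T.functor ⋙ Gens =
        Pseudofunctor.CoGrothendieck.forget (fiberFunctor h).toPseudofunctor' := by
  refine ⟨fun C _ _ _ _ D _ _ _ _ F => ⟨F.io_comp_ff, fun _ => rfl,
      inferInstanceAs (Induced.toBase F.factorData).Full,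
      inferInstanceAs (Induced.toBase F.factorData).Faithful⟩,
    ⟨gensLifts_isCleavage.isFibered, gensLifts_isCleavage, gensLifts_compClosed⟩,
    fun H K F => ⟨HypOF.ioPart_comp_ffPart F, ?_,
      HypOF.isStronglyCartesian_of_fullyFaithful (HypOF.ffPart F)⟩,
    fun Λ A K F => HypOF.mid_eq_pull F,
    ⟨isListed_ι_isEquivalence, gensLiftsListed_isCleavage.isFibered, gensLiftsListed_isCleavage,
      gensLiftsListed_compClosed, gensLiftsListed_idClosed⟩,
    HypOn.pullFunctorial, (TotalOF.toHypOFFunctor _).asEquivalence, fun _ => rfl, fun k => ?_, ?_⟩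
  · rw [← HypOF.genMap_ioPart F]
    exact .map _
  · exact ((Category.id_comp _).trans (Category.comp_id _)).symm
  · exact CategoryTheory.Functor.ext (fun _ => rfl) fun X Y k =>
      (TotalOF.genMap_toHom k).trans ((Category.id_comp _).trans (Category.comp_id _)).symm
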